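/- Let $p$ be a prime, let $K$ be a $p$-adic field (a finite extension of $\mathbb{Q}_p$) and let $L/K$ be a finite, not necessarily Galois, extension with $p \nmid [L:K]$. Let $E/K$ be the normal closure of $L/K$, $G=\mathrm{Gal}(E/K)$, $G'=\mathrm{Gal}(E/L)$, and let $X=G/G'$ be the set of left cosets, on which $G$ acts by left translation $\lambda:G\to\mathrm{Perm}(X)$. Write $\mathfrak{O}_F$ for the valuation ring of a $p$-adic field $F$. Let $H$ be a commutative $K$-Hopf algebra giving a Hopf--Galois structure on $L/K$; that is, $H$ is finite dimensional over $K$, $L$ is an $H$-module algebra, and the $K$-linear map $L\otimes_K H\to \mathrm{End}_K(L)$, $s\otimes h\mapsto (t\mapsto s\,(h\cdot t))$, is bijective. Let $$\mathfrak{A}_H=\{h\in H \mid h\cdot x\in\mathfrak{O}_L \text{ for all } x\in\mathfrak{O}_L\}$$ be the associated order of $\mathfrak{O}_L$ in $H$. For a regular subgroup $N$ of $\mathrm{Perm}(X)$ normalised by $\lambda(G)$, let $G$ act on the group algebra $E[N]$ through the Galois action on the coefficients and through conjugation via $\lambda$ on $N$; the fixed ring $E[N]^G$ inherits its Hopf algebra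 structure from $E[N]$ and acts on $L$ by $\left(\sum_{n} c_n n\right)\cdot x=\sum_n c_n\,(n^{-1}(\overline{1_G}))x$, where $\overline{1_G}=G'\in X$ and a coset $gG'$ is applied to $x\in L$ as $g(x)\in E$. Then $H$, together with its action on $L$, can be identified with $E[N]^G$ for some regular subgroup $N$ of $\mathrm{Perm}(X)$ normalised by $\lambda(G)$; under any such identification $$\mathfrak{A}_H=\mathfrak{O}_E[N]^G ;$$ $\mathfrak{A}_H$ is the unique maximal $\mathfrak{O}_K$-order in $H$; and $\mathfrak{O}_L$ is a free $\mathfrak{A}_H$-module. -/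

import Mathlib

open scoped TensorProduct

noncomputable section

namespace HopfGalois

section Structures

variable (R S H : Type*) [CommRing R] [CommRing S] [Algebra R S] [Ring H] [HopfAlgebra R H]
  [Module H S] [IsScalarTower R H S]

/-- The action of `H` on `S` as an `R`-bilinear map `h ↦ (t ↦ h • t)`. -/
def act : H →ₗ[R] S →ₗ[R] S := (Algebra.lsmul R R S : H →ₐ[R] Module.End R S).toLinearMap

/-- The canonical map `j : S ⊗ H → End_R(S)`, `j (s ⊗ h) t = s * (h • t)`. -/
def canonicalMap : S ⊗[R] H →ₗ[R] Module.End R S :=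
  TensorProduct.lift
    (LinearMap.mk₂ R (fun (s : S) (h : H) => LinearMap.mulLeft R s ∘ₗ act R S H h)
      (fun s s' h => by ext t; simp [add_mul])
      (fun c s h => by ext t; simp)
      (fun s h h' => by ext t; simp [mul_add])
      (fun c s h => by ext t; simp))

theorem canonicalMap_tmul (s : S) (h : H) (t : S) :
    canonicalMap R S H (s ⊗ₜ h) t = s * (h • t) := rfl

/-- `S` is an `H`-Galois extension of `R`, i.e. the given `R`-linear action of the Hopf algebra `H`
on `S` is a Hopf-Galois structure on `S / R`. The field `smul_mul` says
`h • (s * t) = ∑ (h₁ • s) * (h₂ • t)` in Sweedler notation. -/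
structure IsHopfGalois : Prop where
  finite_ext : Module.Finite R S
  projective_ext : Module.Projective R S
  finite_hopf : Module.Finite R H
  projective_hopf : Module.Projective R H
  smul_mul : ∀ (h : H) (s t : S), h • (s * t) =
    LinearMap.mul' R S (TensorProduct.map ((act R S H).flip s) ((act R S H).flip t)
      (Coalgebra.comul (R := R) h))
  smul_one : ∀ h : H, h • (1 : S) = algebraMap R S (Coalgebra.counit h)
  bijective : Function.Bijective (canonicalMap R S H)

end Structures

section Orders

variable (O F : Type*) [CommRing O] [Field F]

/-- An `O`-order in the `F`-algebra `A` (`F` the field of fractions of `O`): an `O`-subalgebra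
which is finitely generated as an `O`-module and spans `A` over `F`. -/
structure IsOrder {A : Type*} [Ring A] [Algebra O A] [Algebra F A] (Λ : Subalgebra O A) : Prop where
  fg : (Subalgebra.toSubmodule Λ).FG
  span_eq_top : Submodule.span F (Λ : Set A) = ⊤

/-- A maximal order: an order not properly contained in another order. -/
def IsMaximalOrder {A : Type*} [Ring A] [Algebra O A] [Algebra F A] (Λ : Subalgebra O A) : Prop :=
  Maximal (IsOrder O F) Λ

/-- `Λ` is the unique maximal order. -/
def IsUniqueMaximalOrder {A : Type*} [Ring A] [Algebra O A] [Algebra F A] (Λ : Subalgebra O A) : Prop :=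
  IsMaximalOrder O F Λ ∧ ∀ Λ' : Subalgebra O A, IsMaximalOrder O F Λ' → Λ' = Λ

end Orders

section PAdic

variable (p : ℕ) [Fact p.Prime]

/-- The valuation ring of a finite extension `F` of `ℚ_p`: the integral closure of `ℤ_p` in `F`. -/
def intRing (F : Type*) [Field F] [Algebra ℚ_[p] F] : Subring F where
  carrier := {x | ((algebraMap ℚ_[p] F).comp (algebraMap ℤ_[p] ℚ_[p])).IsIntegralElem x}
  mul_mem' := RingHom.IsIntegralElem.mul _
  one_mem' := RingHom.isIntegralElem_one _
  add_mem' := RingHom.IsIntegralElem.add _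
  zero_mem' := RingHom.isIntegralElem_zero _
  neg_mem' := RingHom.IsIntegralElem.neg _

theorem algebraMap_mem_intRing {K L : Type*} [Field K] [Field L] [Algebra ℚ_[p] K]
    [Algebra ℚ_[p] L] [Algebra K L] [IsScalarTower ℚ_[p] K L] {c : K} (hc : c ∈ intRing p K) :
    algebraMap K L c ∈ intRing p L := by
  obtain ⟨f, hf, h0⟩ := hc
  refine ⟨f, hf, ?_⟩
  have h := congrArg (algebraMap K L) h0
  rw [Polynomial.hom_eval₂, map_zero, ← RingHom.comp_assoc, ← IsScalarTower.algebraMap_eq] at h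
  exact h

section AssociatedOrder

variable (K L H : Type*) [Field K] [Field L] [Algebra ℚ_[p] K] [Algebra ℚ_[p] L]
  [Algebra K L] [IsScalarTower ℚ_[p] K L] [Ring H] [Algebra K H] [Module H L]
  [IsScalarTower K H L]

/-- The associated order `𝔄_H = {h ∈ H | h • x ∈ 𝔒_L for all x ∈ 𝔒_L}`, as an `𝔒_K`-subalgebra
of `H`. -/
def associatedOrder : Subalgebra (intRing p K) H where
  carrier := {h | ∀ x ∈ intRing p L, h • x ∈ intRing p L}
  mul_mem' {a b} ha hb x hx := by rw [mul_smul]; exact ha _ (hb x hx)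
  add_mem' {a b} ha hb x hx := by rw [add_smul]; exact add_mem (ha x hx) (hb x hx)
  algebraMap_mem' c x hx := by
    have h : algebraMap (intRing p K) H c • x = algebraMap K L c * x := by
      change algebraMap K H c • x = _
      rw [algebraMap_smul, Algebra.smul_def]
    rw [h]
    exact mul_mem (algebraMap_mem_intRing p c.2) hx

/-- `𝔒_L` as a module over the associated order. -/
instance associatedOrderModule : Module (associatedOrder p K L H) (intRing p L) where
  smul a x := ⟨a.1 • x.1, a.2 x.1 x.2⟩
  one_smul x := Subtype.ext (one_smul H x.1)
  mul_smul a b x := Subtype.ext (mul_smul a.1 b.1 x.1)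
  smul_zero a := Subtype.ext (smul_zero a.1)
  smul_add a x y := Subtype.ext (smul_add a.1 x.1 y.1)
  add_smul a b x := Subtype.ext (add_smul a.1 b.1 x.1)
  zero_smul x := Subtype.ext (zero_smul H x.1)

end AssociatedOrder

end PAdic

section GreitherPareigis

variable (K L E : Type*) [Field K] [Field L] [Field E] [Algebra K L] [Algebra K E] [Algebra L E]
  [IsScalarTower K L E]

/-- `G' = Gal(E/L)` as a subgroup of `G = Gal(E/K)`. -/
def galSubgroup : Subgroup Gal(E/K) :=
  (IsScalarTower.toAlgHom K L E).fieldRange.fixingSubgroup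

/-- The left coset space `X = G / G'`. -/
abbrev CosetSpace : Type _ := Gal(E/K) ⧸ galSubgroup K L E

/-- Left translation `λ : G → Perm X`. -/
def leftTranslation : Gal(E/K) →* Equiv.Perm (CosetSpace K L E) :=
  MulAction.toPermHom Gal(E/K) (CosetSpace K L E)

/-- A coset `g G'` applied to `x ∈ L`: the element `g x` of `E`. -/
def cosetApply (c : CosetSpace K L E) (x : L) : E :=
  Quotient.liftOn' c (fun g : Gal(E/K) => g (algebraMap L E x)) (by
    intro g g' h
    rw [QuotientGroup.leftRel_apply] at h
    have h1 := (IntermediateField.mem_fixingSubgroup_iff _ _).1 h (algebraMap L E x) ⟨x, rfl⟩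
    have h2 := congrArg g h1
    simpa using h2.symm)

/-- A regular subgroup `N` of `Perm X` normalised by `λ(G)`. -/
structure RegularSubgroup where
  /-- the subgroup `N` -/
  N : Subgroup (Equiv.Perm (CosetSpace K L E))
  card_eq : Nat.card N = Nat.card (CosetSpace K L E)
  transitive : MulAction.IsPretransitive N (CosetSpace K L E)
  normalised : (leftTranslation K L E).range ≤ Subgroup.normalizer N

namespace RegularSubgroup

variable {K L E} (N : RegularSubgroup K L E)

/-- The action of `g ∈ G` on `N`, `n ↦ λ(g) n λ(g)⁻¹`. -/
def conj (g : Gal(E/K)) : MulAut N.N :=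
  N.N.normalizerMonoidHom ⟨leftTranslation K L E g, N.normalised ⟨g, rfl⟩⟩

theorem coe_conj (g : Gal(E/K)) (n : N.N) :
    (N.conj g n : Equiv.Perm (CosetSpace K L E)) =
      leftTranslation K L E g * n * (leftTranslation K L E g)⁻¹ := rfl

/-- The group algebra `E[N]`. -/
abbrev GroupAlgebra : Type _ := MonoidAlgebra E N.N

/-- The action of `g ∈ G` on `E[N]`, on coefficients by the Galois action and on group elements
by conjugation: `∑ c_n n ↦ ∑ g(c_n) λ(g) n λ(g)⁻¹`. -/
def galAct (g : Gal(E/K)) : N.GroupAlgebra →+* N.GroupAlgebra :=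
  (MonoidAlgebra.mapRingHom N.N (g : E →+* E)).comp
    (MonoidAlgebra.mapDomainRingHom E (N.conj g : N.N →* N.N))

theorem galAct_single (g : Gal(E/K)) (n : N.N) (c : E) :
    N.galAct g (MonoidAlgebra.single n c) = MonoidAlgebra.single (N.conj g n) (g c) := by
  simp [galAct]

/-- The `K`-algebra `E[N]^G`. -/
def fixedAlgebra : Subalgebra K N.GroupAlgebra where
  carrier := {z | ∀ g : Gal(E/K), N.galAct g z = z}
  mul_mem' ha hb g := by rw [map_mul, ha g, hb g]
  add_mem' ha hb g := by rw [map_add, ha g, hb g]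
  algebraMap_mem' c g := by
    simp [galAct_single]

/-- The action of `∑ c_n n` on `x ∈ L`, `x ↦ ∑ c_n (n⁻¹(1̄)) x`, with values in `E` a priori. -/
def apply (z : N.GroupAlgebra) (x : L) : E :=
  z.coeff.sum fun n c =>
    c * cosetApply K L E
      ((n : Equiv.Perm (CosetSpace K L E))⁻¹ ((1 : Gal(E/K)) : CosetSpace K L E)) x

/-- The subset `𝔒_E[N]^G` of `E[N]^G`. -/
def integralFixed (p : ℕ) [Fact p.Prime] [Algebra ℚ_[p] E] : Set N.fixedAlgebra :=
  {z | ∀ n : N.N, (z : N.GroupAlgebra).coeff n ∈ intRing p E}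

end RegularSubgroup

/-- An identification `H = E[N]^G` of a Hopf algebra `H` acting on `L` with `E[N]^G`: an isomorphism
of `K`-algebras under which the counit, the comultiplication and the action on `L` of `H` become
those inherited from `E[N]` (the antipode is then respected automatically). -/
structure Identification (H : Type*) [Ring H] [HopfAlgebra K H] [Module H L]
    (N : RegularSubgroup K L E) where
  /-- the isomorphism of algebras -/
  equiv : H ≃ₐ[K] N.fixedAlgebra
  counit_eq : ∀ h : H,
    Coalgebra.counit (R := E) (equiv h : N.GroupAlgebra) =
      algebraMap K E (Coalgebra.counit (R := K) h)
  /-- `Δ(h)`, sent to `E[N] ⊗[E] E[N]` along `H ⊗[K] H → E[N] ⊗[K] E[N] → E[N] ⊗[E] E[N]`,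
  is the comultiplication of `E[N]` at the image of `h`. -/
  comul_eq : ∀ h : H,
    Coalgebra.comul (R := E) (equiv h : N.GroupAlgebra) =
      TensorProduct.mapOfCompatibleSMul E K K N.GroupAlgebra N.GroupAlgebra
        (TensorProduct.map
          (N.fixedAlgebra.val.toLinearMap ∘ₗ equiv.toLinearMap)
          (N.fixedAlgebra.val.toLinearMap ∘ₗ equiv.toLinearMap)
          (Coalgebra.comul (R := K) h))
  smul_eq : ∀ (h : H) (x : L), algebraMap L E (h • x) = N.apply (equiv h : N.GroupAlgebra) x

end GreitherPareigis

end HopfGalois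

end

/-! The identification is Greither–Pareigis descent. For an embedding `f : L → E`, the action of `H`
gives an isomorphism of `E ⊗ H` onto `Hom_K(L, E)` (`evalAt_injective`, `evalAt_surjective`), under
which the group-like elements are exactly the embeddings (`groupLikeHom_bijective`). Hence `E ⊗ H`
has `[L:K] = dim H` group-like elements. They are linearly independent, so `E ⊗ H` is their group
algebra, and they permute the embeddings, that is, the cosets in `X`, regularly. Taking Galois
invariants recovers `H`.

The arithmetic is a cycle of inclusions: `𝔄_H` ⊆ {elements integral over `ℤ_p`} ⊆ `𝔒_E[N]^G` ⊆
`𝔄_H`. For the first, `𝔄_H` is a finitely generated `ℤ_p`-module, since it embeds in `𝔒_L` by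
evaluation at a vector with zero annihilator. For the second, `N` is abelian because `H` is
commutative, and the trace on `E[N]` shows that `|N|` times each coefficient of an integral element
is integral; `|N| = [L:K]` is a unit in `ℤ_p` (`MonoidAlgebra.isIntegral_coeff`). The third holds
because embeddings preserve integrality.

So `𝔄_H` is the set of all integral elements and contains every order. As `H` is reduced, this ring
is a finite product of principal ideal domains, and `𝔒_L` is isomorphic to a principal ideal of it
generated by a nonzerodivisor (`Submodule.exists_generator_integralClosure`). -/

open scoped TensorProduct

noncomputable section

/-! ### Traces and integrality in the group algebra of a finite abelian group. -/

section Trace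

/-- The eigenvalues of an integral matrix are integral, hence so is its trace. -/
theorem Matrix.isIntegral_trace {R E ι : Type*} [CommRing R] [Field E] [Algebra R E]
    [Fintype ι] [DecidableEq ι] {M : Matrix ι ι E} (hM : IsIntegral R M) :
    IsIntegral R M.trace := by
  let A := AlgebraicClosure E
  have hinj : Function.Injective (algebraMap E A) := (algebraMap E A).injective
  let M' : Matrix ι ι A := M.map (algebraMap E A)
  have hM' : IsIntegral R M' := hM.map ((IsScalarTower.toAlgHom R E A).mapMatrix)
  have htr : algebraMap E A M.trace = M'.trace := by
    simp [M', Matrix.trace, map_sum]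
  rw [← isIntegral_algebraMap_iff hinj, htr, Matrix.trace_eq_sum_roots_charpoly]
  refine IsIntegral.multiset_sum fun μ hμ => ?_
  obtain ⟨q, hq, hq0⟩ := hM'
  refine ⟨q, hq, ?_⟩
  have hroot := Polynomial.isRoot_of_mem_roots hμ
  have hev : Module.End.HasEigenvalue (Matrix.toLin' M') μ := by
    rwa [Module.End.hasEigenvalue_iff_isRoot_charpoly, Matrix.charpoly_toLin']
  obtain ⟨v, hv⟩ := hev.exists_hasEigenvector
  have h0 : Polynomial.aeval (Matrix.toLin' M') (q.map (algebraMap R A)) = 0 := by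
    change Polynomial.aeval (Matrix.toLinAlgEquiv' M') (q.map (algebraMap R A)) = 0
    rw [Polynomial.aeval_algHom_apply, Polynomial.aeval_map_algebraMap]
    have : Polynomial.aeval M' q = 0 := hq0
    rw [this, map_zero]
  have h1 := Module.End.aeval_apply_of_hasEigenvector (p := q.map (algebraMap R A)) hv
  rw [h0, LinearMap.zero_apply, eq_comm, smul_eq_zero] at h1
  have h2 := h1.resolve_right hv.2
  rwa [Polynomial.eval_map] at h2

variable {E N : Type*} [Field E] [CommGroup N] [Finite N]

instance MonoidAlgebra.finite_of_finite : Module.Finite E (MonoidAlgebra E N) :=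
  Module.Finite.equiv (MonoidAlgebra.coeffLinearEquiv (M := N) (S := E) E).symm

/-- In the basis `N`, translation by `n ≠ 1` has no fixed basis vector, so only the coefficient at
`1` reaches the diagonal. -/
theorem MonoidAlgebra.trace_eq (z : MonoidAlgebra E N) :
    Algebra.trace E (MonoidAlgebra E N) z = Nat.card N * z.coeff 1 := by
  classical
  have := Fintype.ofFinite N
  let b : Module.Basis N E (MonoidAlgebra E N) := ⟨MonoidAlgebra.coeffLinearEquiv E⟩
  rw [Algebra.trace_eq_matrix_trace b]
  have : ∀ i, Algebra.leftMulMatrix b z i i = z.coeff 1 := fun i => by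
    rw [Algebra.leftMulMatrix_eq_repr_mul]
    change (z * MonoidAlgebra.single i 1).coeff i = _
    simp
  simp [Matrix.trace, this]

/-- Multiplying by `n⁻¹`, which has finite order and so is integral, moves the coefficient at `n` to
`1`. The trace then yields `|N|` times it, and `|N|` is invertible. This is where `p ∤ [L:K]`
enters. -/
theorem MonoidAlgebra.isIntegral_coeff {R : Type*} [CommRing R] [Algebra R E]
    (hN : IsUnit (Nat.card N : R)) {z : MonoidAlgebra E N} (hz : IsIntegral R z) (n : N) :
    IsIntegral R (z.coeff n) := by
  have h1 : IsIntegral R (MonoidAlgebra.single n⁻¹ (1 : E)) := by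
    refine IsIntegral.of_pow (Nat.card_pos (α := N)) ?_
    rw [MonoidAlgebra.single_pow, pow_card_eq_one', one_pow]
    exact isIntegral_one
  have h3 : IsIntegral R (Algebra.trace E _ (z * MonoidAlgebra.single n⁻¹ 1)) := by
    classical
    let b := Module.finBasis E (MonoidAlgebra E N)
    rw [Algebra.trace_eq_matrix_trace b]
    exact Matrix.isIntegral_trace ((hz.mul h1).map ((Algebra.leftMulMatrix b).restrictScalars R))
  rw [MonoidAlgebra.trace_eq] at h3
  obtain ⟨u, hu⟩ := hN
  have h4 := (isIntegral_algebraMap (R := R) (A := E) (x := ((u⁻¹ : Rˣ) : R))).mul h3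
  have h5 : algebraMap R E ((u⁻¹ : Rˣ) : R) * (Nat.card N : E) = 1 := by
    rw [← map_natCast (algebraMap R E), ← hu, ← map_mul, Units.inv_mul, map_one]
  rw [← mul_assoc, h5, one_mul] at h4
  simpa using h4

/-- Maschke by the same device: the translates of a nilpotent element are nilpotent, hence of trace
zero. -/
theorem MonoidAlgebra.isReduced_of_card_ne_zero (hN : (Nat.card N : E) ≠ 0) :
    IsReduced (MonoidAlgebra E N) where
  eq_zero z hz := by
    ext n
    have h1 : IsNilpotent (z * MonoidAlgebra.single n⁻¹ 1) :=
      (Commute.all _ _).isNilpotent_mul_right hz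
    have h2 := (LinearMap.isNilpotent_trace_of_isNilpotent
      (h1.map (Algebra.lmul E (MonoidAlgebra E N)))).eq_zero
    rw [← Algebra.trace_apply, MonoidAlgebra.trace_eq] at h2
    simpa [hN] using h2

end Trace

/-! ### Integral closures of a discrete valuation ring are principal ideal rings. -/

section IntegralClosure

theorem IsIntegral.pi {R ι : Type*} {A : ι → Type*} [CommRing R] [Finite ι] [∀ i, CommRing (A i)]
    [∀ i, Algebra R (A i)] {x : ∀ i, A i} (hx : ∀ i, IsIntegral R (x i)) : IsIntegral R x := by
  have := Fintype.ofFinite ι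
  choose q hq hq0 using hx
  refine ⟨∏ i, q i, Polynomial.monic_prod_of_monic _ _ fun i _ => hq i, ?_⟩
  funext i
  change (Pi.evalAlgHom R A i) (Polynomial.aeval x (∏ i, q i)) = 0
  rw [← Polynomial.aeval_algHom_apply, map_prod]
  exact Finset.prod_eq_zero (Finset.mem_univ i) (hq0 i)

/-- A Dedekind domain with finitely many maximal ideals is principal; here they all lie over the
single maximal ideal of `R`. -/
theorem integralClosure.isPrincipalIdealRing_of_field (R Q F : Type*) [CommRing R] [IsDomain R]
    [IsDiscreteValuationRing R] [Field Q] [CharZero Q] [Algebra R Q] [IsFractionRing R Q]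
    [Field F] [Algebra Q F] [Algebra R F] [IsScalarTower R Q F] [FiniteDimensional Q F] :
    IsPrincipalIdealRing (integralClosure R F) := by
  have : IsDedekindDomain (integralClosure R F) := integralClosure.isDedekindDomain R Q F
  have : Module.Finite R (integralClosure R F) := IsIntegralClosure.finite R Q F _
  refine IsPrincipalIdealRing.of_finite_maximals
    ((Algebra.QuasiFinite.finite_primesOver (S := integralClosure R F)
      (IsLocalRing.maximalIdeal R)).subset fun P hP => ?_)
  have hP' : P.IsMaximal := hP
  refine ⟨hP'.isPrime, ⟨?_⟩⟩
  exact (IsLocalRing.eq_maximalIdeal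
    (Ideal.isMaximal_comap_of_isIntegral_of_isMaximal (R := R) P)).symm

theorem integralClosure.isPrincipalIdealRing_of_pi {R H ι : Type*} {F : ι → Type*} [CommRing R]
    [Finite ι] [∀ i, CommRing (F i)] [∀ i, Algebra R (F i)] [CommRing H] [Algebra R H]
    [∀ i, IsPrincipalIdealRing (integralClosure R (F i))] (e : H ≃ₐ[R] ∀ i, F i) :
    IsPrincipalIdealRing (integralClosure R H) := by
  let f : (∀ i, integralClosure R (F i)) →+* integralClosure R H :=
    RingHom.codRestrict ((e.symm : (∀ i, F i) →+* H).comp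
      (RingHom.pi fun i => (integralClosure R (F i)).toSubring.subtype.comp (Pi.evalRingHom _ i)))
      (integralClosure R H) fun x => (IsIntegral.pi fun i => (x i).2).map e.symm
  refine IsPrincipalIdealRing.of_surjective f fun x => ?_
  refine ⟨fun i => ⟨e x.1 i, (x.2.map e).map (Pi.evalAlgHom R F i)⟩, Subtype.ext ?_⟩
  exact e.symm_apply_apply x.1

/-- The integral closure of a discrete valuation ring in a reduced finite algebra over its field of
fractions of characteristic zero is a product of principal ideal domains. -/
theorem integralClosure.isPrincipalIdealRing (R Q H : Type*) [CommRing R] [IsDomain R]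
    [IsDiscreteValuationRing R] [Field Q] [CharZero Q] [Algebra R Q] [IsFractionRing R Q]
    [CommRing H] [IsReduced H] [Algebra Q H]
    [Algebra R H] [IsScalarTower R Q H] [FiniteDimensional Q H] :
    IsPrincipalIdealRing (integralClosure R H) := by
  have : IsArtinianRing H := IsArtinianRing.of_finite Q H
  let _ : ∀ m : MaximalSpectrum H, Field (H ⧸ m.asIdeal) := fun _ => Ideal.Quotient.field _
  have _ : ∀ m : MaximalSpectrum H, FiniteDimensional Q (H ⧸ m.asIdeal) := fun m =>
    Module.Finite.of_surjective (Ideal.Quotient.mkₐ Q m.asIdeal).toLinearMap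
      Ideal.Quotient.mk_surjective
  have _ : ∀ m : MaximalSpectrum H, IsPrincipalIdealRing (integralClosure R (H ⧸ m.asIdeal)) :=
    fun m => integralClosure.isPrincipalIdealRing_of_field R Q (H ⧸ m.asIdeal)
  exact integralClosure.isPrincipalIdealRing_of_pi
    ((IsArtinianRing.equivPi H).restrictScalars R)

end IntegralClosure

/-! ### Cyclic vectors, and lattices over the ring of integral elements. -/

section Cyclic

/-- Faithfulness makes each component `ε i • L` nonzero. A sum of nonzero vectors, one from each
component, is killed by no nonzero `h`, since a nonzero coordinate of `h` is invertible in its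
field. -/
theorem exists_smul_eq_zero_imp_of_pi {H L ι : Type*} {F : ι → Type*} [Finite ι] [CommRing H]
    [∀ i, Field (F i)] (e : H ≃+* ∀ i, F i) [AddCommGroup L] [Module H L] [FaithfulSMul H L] :
    ∃ v : L, ∀ h : H, h • v = 0 → h = 0 := by
  classical
  have := Fintype.ofFinite ι
  let ε : ι → H := fun i => e.symm (Pi.single i 1)
  have hε : ∀ i, ∃ l : L, ε i • l ≠ 0 := fun i => by
    by_contra! h0
    have h1 : ε i = 0 := FaithfulSMul.eq_of_smul_eq_smul (α := L) fun l => by rw [h0, zero_smul]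
    have h2 := congrArg e h1
    simp only [ε, RingEquiv.apply_symm_apply, map_zero] at h2
    simpa using congrFun h2 i
  choose l hl using hε
  have hmul : ∀ i j, ε i * ε j = if i = j then ε j else 0 := fun i j => by
    apply e.injective
    split_ifs with hij
    · subst hij
      simp [ε, ← Pi.single_mul]
    · simp only [ε, map_mul, RingEquiv.apply_symm_apply, map_zero]
      funext k
      by_cases hk : k = i
      · subst hk; simp [Pi.single_eq_of_ne hij]
      · simp [Pi.single_eq_of_ne hk]
  refine ⟨∑ i, ε i • l i, fun h hh => e.injective ?_⟩
  rw [map_zero]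
  funext i
  by_contra hi
  refine hl i ?_
  -- Some multiple of `h` is the idempotent `ε i`, so `h` cannot kill the sum without killing `ε i •
  -- l i`.
  have h1 : e.symm (Pi.single i (e h i)⁻¹) * h * ε i = ε i := by
    apply e.injective
    funext j
    by_cases hij : j = i
    · subst hij
      simp [ε, inv_mul_cancel₀ hi]
    · simp [ε, Pi.single_eq_of_ne hij]
  have h2 : ε i • ∑ j, ε j • l j = ε i • l i := by
    simp [Finset.smul_sum, smul_smul, hmul, ite_smul]
  rw [← h1, mul_smul, ← h2, smul_smul, mul_assoc, mul_comm h, ← mul_assoc, mul_smul, hh, smul_zero]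

theorem IsArtinianRing.exists_smul_eq_zero_imp (H L : Type*) [CommRing H] [IsArtinianRing H]
    [IsReduced H] [AddCommGroup L] [Module H L] [FaithfulSMul H L] :
    ∃ v : L, ∀ h : H, h • v = 0 → h = 0 :=
  let _ : ∀ m : MaximalSpectrum H, Field (H ⧸ m.asIdeal) := fun _ => Ideal.Quotient.field _
  exists_smul_eq_zero_imp_of_pi (IsArtinianRing.equivPi H).toRingEquiv

variable {R H L : Type*} [CommRing R] [CommRing H] [Algebra R H] [AddCommGroup L] [Module R L]
  [Module H L] [IsScalarTower R H L]

/-- The elements of `H` which map the `R`-lattice `M` to itself. -/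
def Submodule.stabilizerSubalgebra (H : Type*) [CommRing H] [Algebra R H] [Module H L]
    [IsScalarTower R H L] (M : Submodule R L) : Subalgebra R H where
  carrier := {h | ∀ x ∈ M, h • x ∈ M}
  mul_mem' {a b} ha hb x hx := by rw [mul_smul]; exact ha _ (hb x hx)
  add_mem' {a b} ha hb x hx := by rw [add_smul]; exact add_mem (ha x hx) (hb x hx)
  algebraMap_mem' c x hx := by rw [algebraMap_smul]; exact M.smul_mem c hx

/-- Evaluation at `v` embeds the stabilizer in the noetherian module `M`. -/
theorem Submodule.stabilizerSubalgebra_fg [IsNoetherianRing R] {M : Submodule R L} (hM : M.FG)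
    {v : L} (hvM : v ∈ M) (hv : ∀ h : H, h • v = 0 → h = 0) :
    (Subalgebra.toSubmodule (M.stabilizerSubalgebra H)).FG := by
  have : Module.Finite R M := Module.Finite.of_fg hM
  let f : M.stabilizerSubalgebra H →ₗ[R] M :=
    { toFun := fun h => ⟨h.1 • v, h.2 v hvM⟩
      map_add' := fun a b => Subtype.ext (add_smul a.1 b.1 v)
      map_smul' := fun r a => Subtype.ext (smul_assoc r a.1 v) }
  have hf : Function.Injective f := by
    rw [injective_iff_map_eq_zero]
    exact fun a ha => Subtype.ext (hv a.1 (congrArg Subtype.val ha))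
  have := Module.Finite.of_injective f hf
  exact Module.Finite.iff_fg.1 this

variable (R) in
theorem Submodule.exists_mem_smul_eq_zero_imp (Q : Type*) [Field Q] [Algebra R Q]
    [Algebra Q H] [IsScalarTower R Q H] [IsReduced H] [FiniteDimensional Q H]
    [IsDomain R] [IsFractionRing R Q] [FaithfulSMul H L] {M : Submodule R L}
    (hspan : ∀ x : L, ∃ r : R, r ≠ 0 ∧ r • x ∈ M) :
    ∃ v ∈ M, ∀ h : H, h • v = 0 → h = 0 := by
  have : IsArtinianRing H := IsArtinianRing.of_finite Q H
  obtain ⟨v, hv⟩ := IsArtinianRing.exists_smul_eq_zero_imp H L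
  obtain ⟨r, hr, hrv⟩ := hspan v
  refine ⟨r • v, hrv, fun h hh => ?_⟩
  have h1 : h * algebraMap R H r = 0 := hv _ (by rw [mul_smul, algebraMap_smul, hh])
  have hu : IsUnit (algebraMap R H r) := by
    rw [IsScalarTower.algebraMap_apply R Q H]
    exact (IsUnit.mk0 _ (by simpa using hr)).map _
  exact hu.mul_left_eq_zero.1 h1

/-- A lattice `M` in a faithful module `L` with `dim L = dim H` over the reduced algebra `H`, stable
under the maximal order of `H`, is generated by one element over that order. -/
theorem Submodule.exists_generator_integralClosure (Q : Type*) [Field Q] [CharZero Q] [Algebra R Q]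
    [IsDomain R] [IsDiscreteValuationRing R] [IsFractionRing R Q]
    [Algebra Q H] [IsScalarTower R Q H] [IsReduced H] [FiniteDimensional Q H]
    [Module Q L] [IsScalarTower Q H L] [FiniteDimensional Q L]
    [FaithfulSMul H L] (hdim : Module.finrank Q H = Module.finrank Q L)
    {M : Submodule R L} (hM : M.FG) (hspan : ∀ x : L, ∃ r : R, r ≠ 0 ∧ r • x ∈ M)
    (hstab : integralClosure R H ≤ M.stabilizerSubalgebra H) :
    ∃ w ∈ M, (∀ h : H, h • w = 0 → h = 0) ∧ ∀ x ∈ M, ∃ h ∈ integralClosure R H, h • w = x := by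
  have hunit : ∀ r : R, r ≠ 0 → IsUnit (algebraMap R H r) := fun r hr => by
    rw [IsScalarTower.algebraMap_apply R Q H]
    exact (IsUnit.mk0 _ (by simpa using hr)).map _
  obtain ⟨v, -, hv⟩ := Submodule.exists_mem_smul_eq_zero_imp R Q (H := H) hspan
  have hsurj : ∀ v : L, (∀ h : H, h • v = 0 → h = 0) → ∀ x : L, ∃ h : H, h • v = x := by
    intro v hv
    let φ : H →ₗ[Q] L := (LinearMap.toSpanSingleton H L v).restrictScalars Q
    have hφ : Function.Injective φ := (injective_iff_map_eq_zero φ).2 hv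
    exact (LinearMap.injective_iff_surjective_of_finrank_eq_finrank hdim).1 hφ
  let φ : H →ₗ[R] L := (LinearMap.toSpanSingleton H L v).restrictScalars R
  let φe : H ≃ₗ[R] L := LinearEquiv.ofBijective φ
    ⟨(injective_iff_map_eq_zero φ).2 hv, hsurj v hv⟩
  have hI : (M.comap φ).FG := by
    have : M.comap φ = M.map (φe.symm : L →ₗ[R] H) :=
      (Submodule.map_equiv_eq_comap_symm φe.symm M).symm
    rw [this]
    exact hM.map _
  obtain ⟨r, hr, hrI⟩ : ∃ r : R, r ≠ 0 ∧ ∀ h ∈ M.comap φ, IsIntegral R (r • h) := by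
    obtain ⟨s, hs⟩ := hI
    have : Algebra.IsAlgebraic R Q := IsLocalization.isAlgebraic Q (nonZeroDivisors R)
    have : Algebra.IsAlgebraic R H := Algebra.IsAlgebraic.trans R Q H
    obtain ⟨r, hr, hrs⟩ := Algebra.IsAlgebraic.exists_integral_multiples R s
    refine ⟨r, hr, fun h hh => ?_⟩
    have hle : M.comap φ ≤ (Subalgebra.toSubmodule (integralClosure R H)).comap
        (LinearMap.lsmul R H r) := by
      rw [← hs, Submodule.span_le]
      exact hrs
    exact hle hh
  -- Replacing `v` by `r⁻¹ • v` multiplies the lattice `{h | h • v ∈ M}` by `r`, which puts it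
  -- inside the integral closure. Stability of `M` then makes it an ideal `J`.
  have hr' := hunit r hr
  obtain ⟨u, hu⟩ := hr'
  let v' : L := (↑u⁻¹ : H) • v
  have hv' : ∀ h : H, h • v' = 0 → h = 0 := fun h hh => by
    rw [smul_smul] at hh
    simpa using hv _ hh
  have hJint : ∀ h : H, h • v' ∈ M → IsIntegral R h := fun h hh => by
    rw [smul_smul] at hh
    have := hrI (h * ↑u⁻¹) hh
    rwa [Algebra.smul_def, ← hu, mul_comm h, Units.mul_inv_cancel_left] at this
  let J : Ideal (integralClosure R H) :=
    { carrier := {h | h.1 • v' ∈ M}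
      add_mem' := fun {a b} ha hb => by
        change (a.1 + b.1) • v' ∈ M
        rw [add_smul]; exact M.add_mem ha hb
      zero_mem' := by
        change (0 : H) • v' ∈ M
        rw [zero_smul]; exact M.zero_mem
      smul_mem' := fun c a ha => by
        change (c.1 * a.1) • v' ∈ M
        rw [mul_smul]; exact hstab c.2 _ ha }
  have := integralClosure.isPrincipalIdealRing R Q H
  obtain ⟨a, ha⟩ := (IsPrincipalIdealRing.principal J).principal
  have haJ : a.1 • v' ∈ M := by
    have : a ∈ J := by rw [ha]; exact Submodule.mem_span_singleton_self a
    exact this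
  have hgen : ∀ h : H, h • v' ∈ M → ∃ c : integralClosure R H, c.1 * a.1 = h := fun h hh => by
    have h1 : (⟨h, hJint h hh⟩ : integralClosure R H) ∈ J := hh
    rw [ha] at h1
    obtain ⟨c, hc⟩ := Submodule.mem_span_singleton.1 h1
    exact ⟨c, congrArg Subtype.val hc⟩
  refine ⟨a.1 • v', haJ, fun h hh => ?_, fun x hx => ?_⟩
  -- The ideal contains some nonzero `t` from `R`, a unit of `H`. As `t` is a multiple of the
  -- generator `a`, anything that kills `a` is zero.
  · obtain ⟨t, ht, htv⟩ := hspan v'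
    obtain ⟨c, hc⟩ := hgen (algebraMap R H t) (by rwa [algebraMap_smul])
    rw [smul_smul] at hh
    have h1 := hv' _ hh
    refine (hunit t ht).mul_left_eq_zero.1 ?_
    rw [← hc, mul_left_comm, h1, mul_zero]
  · obtain ⟨h, rfl⟩ := hsurj v' hv' x
    obtain ⟨c, rfl⟩ := hgen h hx
    exact ⟨c.1, c.2, by rw [smul_smul]⟩

end Cyclic

namespace HopfGalois

theorem finiteDimensional_of_isNormalClosure (K L E : Type*) [Field K] [Field L]
    [Field E] [Algebra K L] [Algebra K E] [Module.Finite K L] [IsNormalClosure K L E] :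
    FiniteDimensional K E := by
  have h := (Algebra.IsAlgebraic.isNormalClosure_iff (F := K) (K := L) (L := E)).1 inferInstance
  have h1 : FiniteDimensional K (IntermediateField.normalClosure K L E) :=
    normalClosure.is_finiteDimensional K L E
  rw [h.2] at h1
  exact Module.Finite.equiv (IntermediateField.topEquiv (F := K) (E := E)).toLinearEquiv

/-! ### Cosets in `X` as embeddings of `L` in `E`. -/

section Cosets

variable (K L E : Type*) [Field K] [Field L] [Field E] [Algebra K L] [Algebra K E] [Algebra L E]
  [IsScalarTower K L E]

theorem cosetApply_mk (g : Gal(E/K)) (x : L) :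
    cosetApply K L E (g : CosetSpace K L E) x = g (algebraMap L E x) := rfl

theorem cosetApply_leftTranslation (g : Gal(E/K)) (c : CosetSpace K L E) (x : L) :
    cosetApply K L E (leftTranslation K L E g c) x = g (cosetApply K L E c x) := by
  induction c using QuotientGroup.induction_on with
  | H c => rfl

/-- The `K`-embedding of `L` in `E` given by a coset. -/
def cosetHom (c : CosetSpace K L E) : L →ₐ[K] E :=
  (c.out : Gal(E/K)).toAlgHom.comp (IsScalarTower.toAlgHom K L E)

theorem cosetHom_apply (c : CosetSpace K L E) (x : L) :
    cosetHom K L E c x = cosetApply K L E c x := by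
  conv_rhs => rw [← QuotientGroup.out_eq' c]
  rfl

theorem cosetHom_one : cosetHom K L E ((1 : Gal(E/K)) : CosetSpace K L E) =
    IsScalarTower.toAlgHom K L E :=
  AlgHom.ext fun x => by rw [cosetHom_apply, cosetApply_mk]; rfl

theorem cosetHom_leftTranslation (g : Gal(E/K)) (c : CosetSpace K L E) :
    cosetHom K L E (leftTranslation K L E g c) = g.toAlgHom.comp (cosetHom K L E c) :=
  AlgHom.ext fun x => by
    rw [cosetHom_apply, cosetApply_leftTranslation, ← cosetHom_apply]; rfl

theorem cosetHom_injective : Function.Injective (cosetHom K L E) := by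
  intro c c' h
  induction c using QuotientGroup.induction_on with
  | H g =>
  induction c' using QuotientGroup.induction_on with
  | H g' =>
  rw [QuotientGroup.eq]
  refine (IntermediateField.mem_fixingSubgroup_iff _ _).2 ?_
  rintro _ ⟨x, rfl⟩
  have h1 := DFunLike.congr_fun h x
  rw [cosetHom_apply, cosetHom_apply, cosetApply_mk, cosetApply_mk] at h1
  change g⁻¹ (g' (algebraMap L E x)) = algebraMap L E x
  rw [← h1]
  exact g.symm_apply_apply _

theorem cosetHom_surjective [Normal K E] : Function.Surjective (cosetHom K L E) := by
  intro f
  let f' : L →ₐ[K] f.fieldRange := f.rangeRestrict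
  let φ : E →ₐ[K] E := f'.liftNormal E
  have hφ : ∀ x, φ (algebraMap L E x) = f x := fun x => AlgHom.liftNormal_commutes f' E x
  let g : Gal(E/K) := AlgEquiv.ofBijective φ (AlgHom.normal_bijective K E E φ)
  refine ⟨(g : CosetSpace K L E), AlgHom.ext fun x => ?_⟩
  rw [cosetHom_apply, cosetApply_mk]
  exact hφ x

/-- Cosets correspond to embeddings of `L` in the normal extension `E`. -/
def cosetEquiv [Normal K E] : CosetSpace K L E ≃ (L →ₐ[K] E) :=
  Equiv.ofBijective (cosetHom K L E) ⟨cosetHom_injective K L E, cosetHom_surjective K L E⟩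

theorem card_cosetSpace [Module.Finite K L] [Algebra.IsSeparable K L] [IsNormalClosure K L E] :
    Nat.card (CosetSpace K L E) = Module.finrank K L := by
  have := IsNormalClosure.normal (F := K) (K := L) (L := E)
  rw [Nat.card_congr (cosetEquiv K L E),
    AlgHom.natCard_of_splits K L E (IsNormalClosure.splits (F := K) (K := L) (L := E))]

end Cosets

/-! ### Group-like elements of `E ⊗ H` and embeddings of `L`. -/

section Evaluation

variable {K L E H : Type*} [Field K] [Field L] [Field E] [Algebra K L] [Algebra K E]
  [CommRing H] [HopfAlgebra K H] [Module H L] [IsScalarTower K H L]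

/-- The `E`-linear map `E ⊗ H → Hom_K(L, E)`, `c ⊗ h ↦ (t ↦ c * f (h • t))`. -/
def evalAt (f : L →ₐ[K] E) : E ⊗[K] H →ₗ[E] L →ₗ[K] E :=
  (LinearMap.compRight K f.toLinearMap ∘ₗ act K L H).liftBaseChange E

theorem evalAt_tmul (f : L →ₐ[K] E) (c : E) (h : H) (t : L) :
    evalAt f (c ⊗ₜ h) t = c * f (h • t) := by
  simp [evalAt, act]

theorem evalAt_one (f : L →ₐ[K] E) : evalAt (H := H) f 1 = f.toLinearMap := by
  ext t
  rw [Algebra.TensorProduct.one_def, evalAt_tmul]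
  simp

theorem evalAt_mul_tmul (f : L →ₐ[K] E) (g : E ⊗[K] H) (c : E) (h : H) (t : L) :
    evalAt f (g * (c ⊗ₜ h)) t = c * evalAt f g (h • t) := by
  induction g with
  | zero => simp
  | add a b ha hb => simp [add_mul, mul_add, ha, hb]
  | tmul d h' =>
    rw [Algebra.TensorProduct.tmul_mul_tmul, evalAt_tmul, evalAt_tmul, mul_smul]
    ring

/-- An element `g` that carries `f` to `k` is absorbed into the base embedding. Thus group-like
elements act on embeddings from the right. -/
theorem evalAt_mul {f k : L →ₐ[K] E} {g : E ⊗[K] H} (hg : evalAt f g = k.toLinearMap)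
    (z : E ⊗[K] H) : evalAt f (g * z) = evalAt k z := by
  induction z with
  | zero => simp
  | add a b ha hb => simp [mul_add, ha, hb]
  | tmul c h =>
    ext t
    rw [evalAt_mul_tmul, evalAt_tmul, hg]
    rfl

/-- The `E`-linear functional `a ⊗ b ↦ (a s) * (b t)` on `(E ⊗ H) ⊗ (E ⊗ H)`. -/
def evalAt₂ (f : L →ₐ[K] E) (s t : L) : (E ⊗[K] H) ⊗[E] (E ⊗[K] H) →ₗ[E] E :=
  LinearMap.mul' E E ∘ₗ TensorProduct.map ((evalAt f).flip s) ((evalAt f).flip t)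

theorem evalAt₂_tmul (f : L →ₐ[K] E) (s t : L) (a b : E ⊗[K] H) :
    evalAt₂ f s t (a ⊗ₜ b) = evalAt f a s * evalAt f b t := rfl

theorem evalAt_apply_mul (hH : IsHopfGalois K L H) (f : L →ₐ[K] E) (z : E ⊗[K] H) (s t : L) :
    evalAt f z (s * t) = evalAt₂ f s t (Coalgebra.comul (R := E) z) := by
  induction z with
  | zero => simp
  | add a b ha hb => simp [ha, hb]
  | tmul c h =>
    rw [evalAt_tmul, hH.smul_mul, TensorProduct.comul_tmul]
    generalize Coalgebra.comul (R := K) h = w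
    induction w with
    | zero => simp
    | add a b ha hb => simp only [map_add, mul_add, ha, hb, TensorProduct.tmul_add]
    | tmul a b =>
      simp [evalAt₂_tmul, evalAt_tmul, act]
      ring

theorem evalAt_apply_one (hH : IsHopfGalois K L H) (f : L →ₐ[K] E) (z : E ⊗[K] H) :
    evalAt f z 1 = Coalgebra.counit (R := E) z := by
  induction z with
  | zero => simp
  | add a b ha hb => simp [ha, hb]
  | tmul c h =>
    rw [evalAt_tmul, hH.smul_one, TensorProduct.counit_tmul]
    simp [Algebra.smul_def, mul_comm]

theorem finrank_eq (hH : IsHopfGalois K L H) : Module.finrank K H = Module.finrank K L := by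
  have := hH.finite_ext
  have h := (LinearEquiv.ofBijective _ hH.bijective).finrank_eq
  rw [Module.finrank_tensorProduct, Module.finrank_linearMap] at h
  exact Nat.eq_of_mul_eq_mul_left Module.finrank_pos h

/-- Bijectivity of `canonicalMap` provides all `f ∘ T` with `T ∈ End_K(L)`. Those with `T` of rank
one and image in `K` already span `Hom_K(L, E)` over `E`. -/
theorem evalAt_surjective (hH : IsHopfGalois K L H) (f : L →ₐ[K] E) :
    Function.Surjective (evalAt (H := H) f) := by
  have := hH.finite_ext
  have h1 : ∀ T : Module.End K L, f.toLinearMap ∘ₗ T ∈ LinearMap.range (evalAt (H := H) f) := by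
    intro T
    obtain ⟨w, rfl⟩ := hH.bijective.2 T
    induction w with
    | zero => simp
    | add a b ha hb =>
      rw [map_add, LinearMap.comp_add]
      exact add_mem ha hb
    | tmul s h =>
      refine ⟨f s ⊗ₜ h, ?_⟩
      ext t
      rw [evalAt_tmul, LinearMap.comp_apply, canonicalMap_tmul]
      simp
  let b := Module.finBasis K L
  intro ψ
  rw [← LinearMap.mem_range]
  have h2 : ψ = ∑ i, ψ (b i) • (f.toLinearMap ∘ₗ ((b.coord i).smulRight (1 : L))) := by
    refine b.ext fun j => ?_
    simp [Finsupp.single_apply, apply_ite f]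
  rw [h2]
  exact Submodule.sum_mem _ fun i _ => Submodule.smul_mem _ _ (h1 _)

/-- `evalAt f` is an isomorphism when `L / K` is Hopf-Galois. -/
def evalEquiv (hH : IsHopfGalois K L H) (f : L →ₐ[K] E) : E ⊗[K] H ≃ₗ[E] L →ₗ[K] E :=
  have := hH.finite_ext
  have := hH.finite_hopf
  have h : Module.finrank E (E ⊗[K] H) = Module.finrank E (L →ₗ[K] E) := by
    rw [Module.finrank_baseChange, finrank_eq hH,
      ← ((Module.finBasis K L).constr E).finrank_eq, Module.finrank_fintype_fun_eq_card,
      Fintype.card_fin]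
  have : Module.Finite E (L →ₗ[K] E) := Module.Finite.equiv ((Module.finBasis K L).constr E)
  LinearEquiv.ofBijective (evalAt f)
    ⟨(LinearMap.injective_iff_surjective_of_finrank_eq_finrank h).2 (evalAt_surjective hH f),
      evalAt_surjective hH f⟩

theorem evalAt_injective (hH : IsHopfGalois K L H) (f : L →ₐ[K] E) :
    Function.Injective (evalAt (H := H) f) := (evalEquiv hH f).injective

/-- Evaluation at a `K`-basis of `L` gives coordinates on `E ⊗ H`; their products, which are values
of `evalAt₂`, are coordinates on the tensor square. -/
theorem eq_of_evalAt₂_eq (hH : IsHopfGalois K L H) (f : L →ₐ[K] E)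
    {w w' : (E ⊗[K] H) ⊗[E] (E ⊗[K] H)} (h : ∀ s t, evalAt₂ f s t w = evalAt₂ f s t w') :
    w = w' := by
  have := hH.finite_ext
  let b := Module.finBasis K L
  let B : Module.Basis _ E (E ⊗[K] H) :=
    Module.Basis.ofEquivFun ((evalEquiv hH f).trans (b.constr E).symm)
  have hB : ∀ z i, B.repr z i = evalAt f z (b i) := fun z i => by
    change ((b.constr E).symm (evalEquiv hH f z)) i = _
    rfl
  have hBB : ∀ w i j, (B.tensorProduct B).repr w (i, j) = evalAt₂ f (b i) (b j) w := by
    intro w i j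
    induction w with
    | zero => simp
    | add x y hx hy => simp [hx, hy]
    | tmul x y =>
      rw [Module.Basis.tensorProduct_repr_tmul_apply, hB, hB, evalAt₂_tmul, smul_eq_mul, mul_comm]
  refine (B.tensorProduct B).repr.injective (Finsupp.ext fun ⟨i, j⟩ => ?_)
  rw [hBB, hBB, h]

theorem isGroupLikeElem_of_evalAt_eq (hH : IsHopfGalois K L H) {f k : L →ₐ[K] E} {g : E ⊗[K] H}
    (hg : evalAt f g = k.toLinearMap) : IsGroupLikeElem E g where
  counit_eq_one := by rw [← evalAt_apply_one hH f, hg]; simp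
  comul_eq_tmul_self := eq_of_evalAt₂_eq hH f fun s t => by
    rw [← evalAt_apply_mul hH, evalAt₂_tmul, hg]; simp

/-- A group-like element sends an embedding `f` of `L` to another embedding. -/
def groupLikeHom (hH : IsHopfGalois K L H) (f : L →ₐ[K] E) (g : GroupLike E (E ⊗[K] H)) :
    L →ₐ[K] E :=
  AlgHom.ofLinearMap (evalAt f g.val)
    (by rw [evalAt_apply_one hH, g.2.counit_eq_one])
    (fun s t => by rw [evalAt_apply_mul hH, g.2.comul_eq_tmul_self, evalAt₂_tmul])

theorem groupLikeHom_toLinearMap (hH : IsHopfGalois K L H) (f : L →ₐ[K] E)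
    (g : GroupLike E (E ⊗[K] H)) : (groupLikeHom hH f g).toLinearMap = evalAt f g.val := rfl

/-- The source of regularity. Being group-like means precisely that the induced map `L → E` respects
products and `1`, so the linear isomorphism `evalAt f` matches group-like elements with embeddings.
-/
theorem groupLikeHom_bijective (hH : IsHopfGalois K L H) (f : L →ₐ[K] E) :
    Function.Bijective (groupLikeHom hH f) := by
  refine ⟨fun g g' h => ?_, fun k => ?_⟩
  · refine GroupLike.val_injective (evalAt_injective hH f ?_)
    rw [← groupLikeHom_toLinearMap hH, h, groupLikeHom_toLinearMap]
  · obtain ⟨g, hg⟩ := evalAt_surjective hH f k.toLinearMap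
    exact ⟨⟨g, isGroupLikeElem_of_evalAt_eq hH hg⟩, AlgHom.toLinearMap_injective hg⟩

theorem groupLikeHom_one (hH : IsHopfGalois K L H) (f : L →ₐ[K] E) :
    groupLikeHom hH f 1 = f :=
  AlgHom.toLinearMap_injective (evalAt_one f)

theorem groupLikeHom_mul (hH : IsHopfGalois K L H) (f : L →ₐ[K] E)
    (g g' : GroupLike E (E ⊗[K] H)) :
    groupLikeHom hH f (g * g') = groupLikeHom hH (groupLikeHom hH f g) g' :=
  AlgHom.toLinearMap_injective (evalAt_mul (groupLikeHom_toLinearMap hH f g) g'.val)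

end Evaluation

/-! ### The Galois action on `E ⊗ H` and its invariants. -/

section GaloisAction

variable {K L E H : Type*} [Field K] [Field L] [Field E] [Algebra K L] [Algebra K E]
  [CommRing H] [HopfAlgebra K H] [Module H L] [IsScalarTower K H L]

variable (H) in
/-- The action of `σ ∈ Gal(E/K)` on the coefficients of `E ⊗ H`. -/
def coeffAct (σ : Gal(E/K)) : E ⊗[K] H ≃ₐ[K] E ⊗[K] H :=
  Algebra.TensorProduct.congr σ AlgEquiv.refl

theorem coeffAct_tmul (σ : Gal(E/K)) (c : E) (h : H) : coeffAct H σ (c ⊗ₜ h) = σ c ⊗ₜ h := rfl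

theorem coeffAct_smul (σ : Gal(E/K)) (c : E) (z : E ⊗[K] H) :
    coeffAct H σ (c • z) = σ c • coeffAct H σ z := by
  induction z with
  | zero => simp
  | add a b ha hb => simp only [smul_add, map_add, ha, hb]
  | tmul d h => simp [TensorProduct.smul_tmul', coeffAct_tmul]

theorem evalAt_coeffAct (σ : Gal(E/K)) (f : L →ₐ[K] E) (z : E ⊗[K] H) :
    evalAt (σ.toAlgHom.comp f) (coeffAct H σ z) = σ.toLinearMap ∘ₗ evalAt f z := by
  induction z with
  | zero => simp
  | add a b ha hb => simp only [map_add, ha, hb, LinearMap.comp_add]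
  | tmul d h => ext t; simp [evalAt_tmul, coeffAct_tmul]

/-- The action of `Gal(E/K)` on the group-like elements of `E ⊗ H`. -/
def groupLikeAct (hH : IsHopfGalois K L H) (f : L →ₐ[K] E) (σ : Gal(E/K)) :
    GroupLike E (E ⊗[K] H) →* GroupLike E (E ⊗[K] H) where
  toFun g := ⟨coeffAct H σ g.val, isGroupLikeElem_of_evalAt_eq
    (k := σ.toAlgHom.comp (groupLikeHom hH f g)) hH (evalAt_coeffAct σ f g.val)⟩
  map_one' := GroupLike.val_injective (map_one (coeffAct H σ))
  map_mul' a b := GroupLike.val_injective (map_mul (coeffAct H σ) a.val b.val)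

/-- The embeddings `f` and `f'` may differ because `f'` serves only to certify that the image is
group-like. -/
theorem groupLikeHom_groupLikeAct (hH : IsHopfGalois K L H) (f f' : L →ₐ[K] E) (σ : Gal(E/K))
    (g : GroupLike E (E ⊗[K] H)) :
    groupLikeHom hH (σ.toAlgHom.comp f) (groupLikeAct hH f' σ g) =
      σ.toAlgHom.comp (groupLikeHom hH f g) :=
  AlgHom.toLinearMap_injective (evalAt_coeffAct σ f g.val)

/-- Galois descent by coordinates: in a `K`-basis of `H` the action is coefficientwise, so invariant
elements have coordinates in `K`. -/
theorem exists_of_coeffAct_eq [FiniteDimensional K E] [IsGalois K E] {z : E ⊗[K] H}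
    (hz : ∀ σ : Gal(E/K), coeffAct H σ z = z) : ∃ h : H, z = 1 ⊗ₜ h := by
  let b := Module.Free.chooseBasis K H
  let B := b.baseChange E
  have h1 : ∀ σ i, B.repr (coeffAct H σ z) i = σ (B.repr z i) := fun σ i => by
    clear hz
    induction z with
    | zero => simp
    | add x y hx hy => simp [hx, hy]
    | tmul c h => simp [B, coeffAct_tmul, Module.Basis.baseChange_repr_tmul]
  have h2 : ∀ i, ∃ a : K, algebraMap K E a = B.repr z i := fun i =>
    (IsGalois.mem_range_algebraMap_iff_fixed _).2 fun σ => by rw [← h1, hz]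
  choose a ha using h2
  refine ⟨∑ i ∈ (B.repr z).support, a i • b i, ?_⟩
  conv_lhs => rw [← B.linearCombination_repr z, Finsupp.linearCombination_apply]
  rw [TensorProduct.tmul_sum, Finsupp.sum]
  refine Finset.sum_congr rfl fun i _ => ?_
  rw [← ha i, Module.Basis.baseChange_apply, TensorProduct.tmul_smul, algebraMap_smul]

end GaloisAction

section Apply

variable {K L E : Type*} [Field K] [Field L] [Field E] [Algebra K L] [Algebra K E] [Algebra L E]
  [IsScalarTower K L E]

theorem RegularSubgroup.apply_single (N : RegularSubgroup K L E) (n : N.N) (c : E) (x : L) :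
    N.apply (MonoidAlgebra.single n c) x = c * cosetApply K L E
      ((n : Equiv.Perm (CosetSpace K L E))⁻¹ ((1 : Gal(E/K)) : CosetSpace K L E)) x := by
  rw [RegularSubgroup.apply, MonoidAlgebra.coeff_single, Finsupp.sum_single_index (by simp)]

theorem RegularSubgroup.apply_add (N : RegularSubgroup K L E) (a b : N.GroupAlgebra) (x : L) :
    N.apply (a + b) x = N.apply a x + N.apply b x := by
  rw [RegularSubgroup.apply, MonoidAlgebra.coeff_add, Finsupp.sum_add_index'
    (fun _ => by simp) (fun _ _ _ => by ring)]
  rfl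

end Apply

/-! ### The regular subgroup attached to a Hopf–Galois structure. -/

section Regular

variable {K L E H : Type*} [Field K] [Field L] [Field E] [Algebra K L] [Algebra K E] [Algebra L E]
  [IsScalarTower K L E] [Normal K E]
  [CommRing H] [HopfAlgebra K H] [Module H L] [IsScalarTower K H L]

/-- The permutation representation of the group-like elements of `E ⊗ H` on the coset space:
`g` sends the embedding `f` to `f ∘ g⁻¹`. -/
def groupLikePerm (hH : IsHopfGalois K L H) :
    GroupLike E (E ⊗[K] H) →* Equiv.Perm (CosetSpace K L E) :=
  MonoidHom.toHomPerm
    -- The inverse turns the right action on embeddings into a left one; it cancels against the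
    -- `n⁻¹` in `RegularSubgroup.apply`.
    { toFun := fun g c => (cosetEquiv K L E).symm (groupLikeHom hH (cosetEquiv K L E c) g⁻¹)
      map_one' := by
        funext c
        rw [inv_one, groupLikeHom_one, Equiv.symm_apply_apply]
        rfl
      map_mul' := fun a b => by
        funext c
        change _ = (cosetEquiv K L E).symm (groupLikeHom hH (cosetEquiv K L E
          ((cosetEquiv K L E).symm (groupLikeHom hH (cosetEquiv K L E c) b⁻¹))) a⁻¹)
        rw [Equiv.apply_symm_apply, ← groupLikeHom_mul, mul_inv_rev] }

theorem cosetHom_groupLikePerm (hH : IsHopfGalois K L H) (g : GroupLike E (E ⊗[K] H))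
    (c : CosetSpace K L E) :
    cosetHom K L E (groupLikePerm hH g c) = groupLikeHom hH (cosetHom K L E c) g⁻¹ :=
  (cosetEquiv K L E).apply_symm_apply _

theorem groupLikePerm_apply_bijective (hH : IsHopfGalois K L H) (c : CosetSpace K L E) :
    Function.Bijective fun g : GroupLike E (E ⊗[K] H) => groupLikePerm hH g c :=
  (cosetEquiv K L E).symm.bijective.comp
    ((groupLikeHom_bijective hH (cosetHom K L E c)).comp (Equiv.inv _).bijective)

theorem groupLikePerm_injective (hH : IsHopfGalois K L H) :
    Function.Injective (groupLikePerm (E := E) hH) := fun _ _ h =>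
  (groupLikePerm_apply_bijective hH ((1 : Gal(E/K)) : CosetSpace K L E)).1 (DFunLike.congr_fun h _)

/-- Left translation by `σ` is composition of embeddings with `σ`, so this is the Galois
equivariance of `evalAt`. It shows that the image is normalised by `λ(G)`. -/
theorem conj_groupLikePerm (hH : IsHopfGalois K L H) (f : L →ₐ[K] E) (σ : Gal(E/K))
    (g : GroupLike E (E ⊗[K] H)) :
    leftTranslation K L E σ * groupLikePerm hH g * (leftTranslation K L E σ)⁻¹ =
      groupLikePerm hH (groupLikeAct hH f σ g) := by
  rw [mul_inv_eq_iff_eq_mul]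
  ext1 c
  refine cosetHom_injective K L E ?_
  rw [Equiv.Perm.mul_apply, Equiv.Perm.mul_apply, cosetHom_leftTranslation, cosetHom_groupLikePerm,
    cosetHom_groupLikePerm, cosetHom_leftTranslation, ← map_inv, groupLikeHom_groupLikeAct]

/-- The regular subgroup of `Perm X` attached to a Hopf-Galois structure. -/
def regularSubgroup (hH : IsHopfGalois K L H) : RegularSubgroup K L E where
  N := (groupLikePerm hH).range
  card_eq := Nat.card_congr (
    (MonoidHom.ofInjective (groupLikePerm_injective (E := E) hH)).symm.toEquiv.trans
    (Equiv.ofBijective _ (groupLikePerm_apply_bijective hH ((1 : Gal(E/K)) : CosetSpace K L E))))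
  transitive := ⟨fun x y => by
    obtain ⟨g, hg⟩ := (groupLikePerm_apply_bijective hH x).2 y
    exact ⟨⟨groupLikePerm hH g, g, rfl⟩, hg⟩⟩
  normalised := by
    have key : ∀ (σ : Gal(E/K)), ∀ n ∈ (groupLikePerm (E := E) hH).range,
        leftTranslation K L E σ * n * (leftTranslation K L E σ)⁻¹ ∈ (groupLikePerm hH).range := by
      rintro σ _ ⟨g, rfl⟩
      exact ⟨groupLikeAct hH (IsScalarTower.toAlgHom K L E) σ g,
        (conj_groupLikePerm hH _ σ g).symm⟩
    rintro _ ⟨σ, rfl⟩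
    refine Subgroup.mem_normalizer_iff.2 fun n => ⟨key σ n, fun h => ?_⟩
    have h1 := key σ⁻¹ _ h
    rw [map_inv] at h1
    simpa [mul_assoc] using h1

end Regular

/-! ### The isomorphism of `H` with `E[N]^G`. -/

section Descent

variable {K L E H : Type*} [Field K] [Field L] [Field E] [Algebra K L] [Algebra K E] [Algebra L E]
  [IsScalarTower K L E] [Normal K E]
  [CommRing H] [HopfAlgebra K H] [Module H L] [IsScalarTower K H L]

variable (E) in
/-- The group-like elements of `E ⊗ H` as the regular subgroup of `Perm X`. -/
def groupLikeEquiv (hH : IsHopfGalois K L H) :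
    GroupLike E (E ⊗[K] H) ≃* (regularSubgroup (E := E) hH).N :=
  MonoidHom.ofInjective (groupLikePerm_injective hH)

theorem coe_groupLikeEquiv (hH : IsHopfGalois K L H) (g : GroupLike E (E ⊗[K] H)) :
    (groupLikeEquiv E hH g : Equiv.Perm (CosetSpace K L E)) = groupLikePerm hH g := rfl

theorem conj_groupLikeEquiv (hH : IsHopfGalois K L H) (σ : Gal(E/K))
    (g : GroupLike E (E ⊗[K] H)) :
    (regularSubgroup hH).conj σ (groupLikeEquiv E hH g) =
      groupLikeEquiv E hH (groupLikeAct hH (IsScalarTower.toAlgHom K L E) σ g) :=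
  Subtype.ext (conj_groupLikePerm hH _ σ g)

/-- Group-like elements are linearly independent, and there are as many of them as cosets, namely
`[L:K] = dim H`. -/
theorem liftGroupLikeBialgHom_bijective [Module.Finite K L] [CharZero K]
    [IsNormalClosure K L E] (hH : IsHopfGalois K L H) :
    Function.Bijective
      (MonoidAlgebra.liftGroupLikeBialgHom : MonoidAlgebra E (GroupLike E (E ⊗[K] H)) →ₐc[E] _) := by
  let T : MonoidAlgebra E (GroupLike E (E ⊗[K] H)) →ₗ[E] E ⊗[K] H :=
    (MonoidAlgebra.liftGroupLikeBialgHom : _ →ₐc[E] E ⊗[K] H)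
  have hinj : Function.Injective T := by
    have h1 : T = Finsupp.linearCombination E (GroupLike.val (R := E) (A := E ⊗[K] H)) ∘ₗ
        (MonoidAlgebra.coeffLinearEquiv E).toLinearMap := by
      refine LinearMap.ext fun z => ?_
      induction z using MonoidAlgebra.induction_linear with
      | zero => simp
      | add a b ha hb => rw [map_add, map_add, ha, hb]
      | single g c => simp [T]
    rw [h1]
    have h2 : LinearIndependent E (GroupLike.val (R := E) (A := E ⊗[K] H)) := linearIndep_groupLikeVal
    exact Function.Injective.comp (g := Finsupp.linearCombination E _) h2
      (MonoidAlgebra.coeffLinearEquiv E).injective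
  have := hH.finite_hopf
  have hfin : Finite (GroupLike E (E ⊗[K] H)) :=
    linearIndep_groupLikeVal.finite
  have hcard : Nat.card (GroupLike E (E ⊗[K] H)) = Module.finrank K L := by
    rw [← card_cosetSpace K L E, Nat.card_congr (Equiv.ofBijective _
      (groupLikePerm_apply_bijective hH ((1 : Gal(E/K)) : CosetSpace K L E)))]
  have hdim : Module.finrank E (MonoidAlgebra E (GroupLike E (E ⊗[K] H))) =
      Module.finrank E (E ⊗[K] H) := by
    rw [(MonoidAlgebra.coeffLinearEquiv E).finrank_eq, Module.finrank_baseChange, finrank_eq hH,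
      ← hcard]
    have := Fintype.ofFinite (GroupLike E (E ⊗[K] H))
    rw [Module.finrank_finsupp_self, Nat.card_eq_fintype_card]
  exact ⟨hinj, (LinearMap.injective_iff_surjective_of_finrank_eq_finrank hdim).1 hinj⟩

variable [Module.Finite K L] [CharZero K] [IsNormalClosure K L E]

variable (E) in
/-- The isomorphism of bialgebras `E[N] ≃ E ⊗ H`. -/
def groupAlgebraEquiv (hH : IsHopfGalois K L H) :
    (regularSubgroup (E := E) hH).GroupAlgebra ≃ₐc[E] E ⊗[K] H :=
  (MonoidAlgebra.domCongrBialgEquiv E E (groupLikeEquiv E hH).symm).trans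
    (BialgEquiv.ofBijective _ (liftGroupLikeBialgHom_bijective hH))

theorem groupAlgebraEquiv_single (hH : IsHopfGalois K L H) (g : GroupLike E (E ⊗[K] H)) (c : E) :
    groupAlgebraEquiv E hH (MonoidAlgebra.single (groupLikeEquiv E hH g) c) = c • g.val := by
  change MonoidAlgebra.liftGroupLikeBialgHom (MonoidAlgebra.domCongr E E (groupLikeEquiv E hH).symm
    (MonoidAlgebra.single (groupLikeEquiv E hH g) c)) = _
  simp

theorem groupAlgebraEquiv_galAct (hH : IsHopfGalois K L H) (σ : Gal(E/K))
    (z : (regularSubgroup (E := E) hH).GroupAlgebra) :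
    groupAlgebraEquiv E hH ((regularSubgroup hH).galAct σ z) =
      coeffAct H σ (groupAlgebraEquiv E hH z) := by
  induction z using MonoidAlgebra.induction_linear with
  | zero => simp
  | add a b ha hb => simp only [map_add, ha, hb]
  | single n c =>
    obtain ⟨g, rfl⟩ := (groupLikeEquiv E hH).surjective n
    rw [RegularSubgroup.galAct_single, conj_groupLikeEquiv, groupAlgebraEquiv_single,
      groupAlgebraEquiv_single, coeffAct_smul]
    rfl

theorem apply_eq_evalAt (hH : IsHopfGalois K L H) (z : (regularSubgroup (E := E) hH).GroupAlgebra)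
    (x : L) : (regularSubgroup hH).apply z x =
      evalAt (IsScalarTower.toAlgHom K L E) (groupAlgebraEquiv E hH z) x := by
  induction z using MonoidAlgebra.induction_linear with
  | zero => simp [RegularSubgroup.apply]
  | add a b ha hb => rw [RegularSubgroup.apply_add, ha, hb, map_add, map_add, LinearMap.add_apply]
  | single n c =>
    obtain ⟨g, rfl⟩ := (groupLikeEquiv E hH).surjective n
    rw [RegularSubgroup.apply_single, groupAlgebraEquiv_single, map_smul, LinearMap.smul_apply,
      smul_eq_mul, coe_groupLikeEquiv, ← map_inv, ← cosetHom_apply, cosetHom_groupLikePerm, inv_inv,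
      cosetHom_one, ← groupLikeHom_toLinearMap hH]
    rfl

variable (E) in
/-- The embedding of `H` in `E[N]`. -/
def toGroupAlgebra (hH : IsHopfGalois K L H) :
    H →ₐ[K] (regularSubgroup (E := E) hH).GroupAlgebra :=
  (((groupAlgebraEquiv E hH).symm.toAlgEquiv.toAlgHom).restrictScalars K).comp
    Algebra.TensorProduct.includeRight

theorem groupAlgebraEquiv_toGroupAlgebra (hH : IsHopfGalois K L H) (h : H) :
    groupAlgebraEquiv E hH (toGroupAlgebra E hH h) = 1 ⊗ₜ h :=
  (groupAlgebraEquiv E hH).apply_symm_apply _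

theorem toGroupAlgebra_mem (hH : IsHopfGalois K L H) (h : H) :
    toGroupAlgebra E hH h ∈ (regularSubgroup (E := E) hH).fixedAlgebra := fun σ => by
  refine (groupAlgebraEquiv E hH).injective ?_
  change groupAlgebraEquiv E hH _ = groupAlgebraEquiv E hH _
  rw [groupAlgebraEquiv_galAct, groupAlgebraEquiv_toGroupAlgebra, coeffAct_tmul, map_one]

theorem toGroupAlgebra_bijective (hH : IsHopfGalois K L H) :
    Function.Bijective ((toGroupAlgebra E hH).codRestrict
      (regularSubgroup (E := E) hH).fixedAlgebra (toGroupAlgebra_mem hH)) := by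
  have := finiteDimensional_of_isNormalClosure K L E
  have : IsGalois K E := { }
  refine ⟨fun a b hab => ?_, fun z => ?_⟩
  · have h1 : (1 : E) ⊗ₜ[K] a = 1 ⊗ₜ b := by
      rw [← groupAlgebraEquiv_toGroupAlgebra hH, ← groupAlgebraEquiv_toGroupAlgebra hH]
      exact congrArg _ (congrArg Subtype.val hab)
    exact Algebra.TensorProduct.includeRight_injective (algebraMap K E).injective h1
  · obtain ⟨h, hh⟩ := exists_of_coeffAct_eq (z := groupAlgebraEquiv E hH z.1) fun σ => by
      rw [← groupAlgebraEquiv_galAct, z.2 σ]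
    refine ⟨h, Subtype.ext ((groupAlgebraEquiv E hH).injective ?_)⟩
    exact (groupAlgebraEquiv_toGroupAlgebra hH h).trans hh.symm

theorem comul_toGroupAlgebra (hH : IsHopfGalois K L H) (h : H) :
    Coalgebra.comul (R := E) (toGroupAlgebra E hH h) =
      TensorProduct.mapOfCompatibleSMul E K K _ _
        (TensorProduct.map (toGroupAlgebra E hH).toLinearMap (toGroupAlgebra E hH).toLinearMap
          (Coalgebra.comul (R := K) h)) := by
  have h1 := CoalgHomClass.map_comp_comul_apply (R := E) (groupAlgebraEquiv E hH).symm
    ((1 : E) ⊗ₜ[K] h)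
  refine h1.symm.trans ?_
  rw [TensorProduct.comul_tmul]
  generalize Coalgebra.comul (R := K) h = w
  induction w with
  | zero => simp
  | add a b ha hb => simp only [map_add, ha, hb, TensorProduct.tmul_add]
  | tmul a b => rfl

/-- The identification of `H` with `E[N]^G`. -/
def identification (hH : IsHopfGalois K L H) :
    Identification K L E H (regularSubgroup hH) where
  equiv := AlgEquiv.ofBijective _ (toGroupAlgebra_bijective (E := E) hH)
  counit_eq h := by
    have h1 := CoalgHomClass.counit_comp_apply (R := E) (groupAlgebraEquiv E hH).symm
      ((1 : E) ⊗ₜ[K] h)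
    refine h1.trans ?_
    rw [TensorProduct.counit_tmul, Algebra.smul_def]
    simp
  comul_eq h := comul_toGroupAlgebra hH h
  smul_eq h x := by
    refine Eq.trans ?_ (apply_eq_evalAt hH (toGroupAlgebra E hH h) x).symm
    rw [groupAlgebraEquiv_toGroupAlgebra, evalAt_tmul, one_mul]
    rfl

end Descent

/-! ### Commutativity of `N` from that of `E[N]^G`. -/

section Commutativity

/-- Independence of the automorphisms of `E`, with coefficients in a vector space. -/
theorem eq_zero_of_sum_smul_eq_zero {K E V : Type*} [Field K] [Field E] [Algebra K E]
    [FiniteDimensional K E] [AddCommGroup V] [Module E V] (d : Gal(E/K) → V)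
    (hd : ∀ c : E, ∑ g : Gal(E/K), g c • d g = 0) (g : Gal(E/K)) : d g = 0 := by
  let B := Module.Free.chooseBasis E V
  have hli := (linearIndependent_algHom_toLinearMap K E E).comp _
    (AlgEquiv.coe_toAlgHom_injective (R := K) (A₁ := E) (A₂ := E))
  refine B.repr.injective (Finsupp.ext fun i => ?_)
  rw [map_zero, Finsupp.zero_apply]
  refine Fintype.linearIndependent_iff.1 hli (fun g => B.repr (d g) i) (LinearMap.ext fun c => ?_) g
  have h1 := DFunLike.congr_fun (congrArg B.repr (hd c)) i
  simpa [mul_comm] using h1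

variable {K L E : Type*} [Field K] [Field L] [Field E] [Algebra K L] [Algebra K E] [Algebra L E]
  [IsScalarTower K L E]

namespace RegularSubgroup

variable (N : RegularSubgroup K L E)

theorem conj_mul (g g' : Gal(E/K)) (n : N.N) : N.conj (g * g') n = N.conj g (N.conj g' n) :=
  Subtype.ext (by simp only [coe_conj, map_mul]; group)

theorem conj_one (n : N.N) : N.conj 1 n = n :=
  Subtype.ext (by simp [coe_conj])

variable [FiniteDimensional K E]

/-- The trace over `Gal(E/K)` of `c n ∈ E[N]`. -/
def traceSingle (n : N.N) (c : E) : N.GroupAlgebra :=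
  ∑ g : Gal(E/K), MonoidAlgebra.single (N.conj g n) (g c)

theorem traceSingle_mem (n : N.N) (c : E) : N.traceSingle n c ∈ N.fixedAlgebra := fun g => by
  simp only [traceSingle, map_sum, galAct_single, ← conj_mul]
  exact Fintype.sum_equiv (Equiv.mulLeft g) _ _ fun _ => rfl

/-- The commutator of `w` with the trace of `c n` is a sum over `g` of `g c` times the commutator
with the conjugate of `n` by `g`. As it vanishes for every `c`, independence of automorphisms kills
each term; `g = 1` gives the claim. -/
theorem commute_single_of_commute_traceSingle {w : N.GroupAlgebra}
    (hw : ∀ n c, Commute w (N.traceSingle n c)) (n : N.N) :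
    Commute w (MonoidAlgebra.single n 1) := by
  have h := eq_zero_of_sum_smul_eq_zero (K := K) (E := E) (V := N.GroupAlgebra)
    (fun g => w * MonoidAlgebra.single (N.conj g n) 1 - MonoidAlgebra.single (N.conj g n) 1 * w)
    (fun c => ?_) 1
  · rw [conj_one, sub_eq_zero] at h
    exact h
  · have h1 := (hw n c).eq
    rw [traceSingle, Finset.mul_sum, Finset.sum_mul, ← sub_eq_zero, ← Finset.sum_sub_distrib] at h1
    rw [← h1]
    refine Finset.sum_congr rfl fun g _ => ?_
    have h2 : (MonoidAlgebra.single (N.conj g n) (g c) : N.GroupAlgebra) =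
        g c • MonoidAlgebra.single (N.conj g n) 1 := by simp
    rw [h2, mul_smul_comm, smul_mul_assoc, smul_sub]

/-- If `E[N]^G` is commutative then so is `N`. -/
theorem mul_comm_of_fixedAlgebra (h : ∀ a ∈ N.fixedAlgebra, ∀ b ∈ N.fixedAlgebra, a * b = b * a)
    (m n : N.N) : m * n = n * m := by
  -- The traces lie in the fixed algebra and commute with each other; the previous lemma frees the
  -- two factors from the trace one at a time.
  have h1 : ∀ n c m, Commute (N.traceSingle n c) (MonoidAlgebra.single m 1) := fun n c m =>
    N.commute_single_of_commute_traceSingle (fun n' c' =>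
      h _ (N.traceSingle_mem n c) _ (N.traceSingle_mem n' c')) m
  have h2 := (N.commute_single_of_commute_traceSingle (fun n' c' => (h1 n' c' m).symm) n).eq
  simp only [MonoidAlgebra.single_mul_single, mul_one] at h2
  exact MonoidAlgebra.single_left_injective one_ne_zero h2

end RegularSubgroup

end Commutativity

/-! ### Integral elements, `𝔒_E[N]^G` and the associated order. -/

section Padic

variable (p : ℕ) [Fact p.Prime]

theorem isUnit_natCast_padicInt {n : ℕ} (hn : ¬ p ∣ n) : IsUnit (n : ℤ_[p]) := by
  rw [PadicInt.isUnit_iff, PadicInt.norm_natCast_eq_one_iff]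
  exact ((Nat.Prime.coprime_iff_not_dvd Fact.out).2 hn)

theorem mem_intRing_iff {F : Type*} [Field F] [Algebra ℚ_[p] F] [Algebra ℤ_[p] F]
    [IsScalarTower ℤ_[p] ℚ_[p] F] {x : F} : x ∈ intRing p F ↔ IsIntegral ℤ_[p] x := by
  rw [IsIntegral, IsScalarTower.algebraMap_eq ℤ_[p] ℚ_[p] F]
  rfl

theorem RegularSubgroup.apply_mem_intRing {K L E : Type*} [Field K] [Field L] [Field E]
    [Algebra K L] [Algebra K E] [Algebra L E] [IsScalarTower K L E] [Algebra ℚ_[p] K]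
    [Algebra ℚ_[p] L] [Algebra ℚ_[p] E] [IsScalarTower ℚ_[p] K L] [IsScalarTower ℚ_[p] K E]
    (N : RegularSubgroup K L E) {z : N.GroupAlgebra} (hz : ∀ n, z.coeff n ∈ intRing p E) {x : L}
    (hx : x ∈ intRing p L) : N.apply z x ∈ intRing p E := by
  refine sum_mem fun n _ => mul_mem (hz n) ?_
  rw [← cosetHom_apply]
  obtain ⟨f, hf, h0⟩ := hx
  refine ⟨f, hf, ?_⟩
  have h := congrArg (cosetHom K L E
    ((n : Equiv.Perm (CosetSpace K L E))⁻¹ ((1 : Gal(E/K)) : CosetSpace K L E)) : L →+* E) h0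
  rw [Polynomial.hom_eval₂, map_zero, ← RingHom.comp_assoc] at h
  have hc : ∀ σ : L →ₐ[K] E, (σ : L →+* E).comp (algebraMap ℚ_[p] L) = algebraMap ℚ_[p] E := by
    intro σ
    rw [IsScalarTower.algebraMap_eq ℚ_[p] K L, ← RingHom.comp_assoc, AlgHom.comp_algebraMap,
      ← IsScalarTower.algebraMap_eq]
  rwa [hc] at h

theorem faithfulSMul {K L H : Type*} [Field K] [Field L] [Algebra K L] [CommRing H]
    [HopfAlgebra K H] [Module H L] [IsScalarTower K H L] (hH : IsHopfGalois K L H) :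
    FaithfulSMul H L where
  eq_of_smul_eq_smul {a b} h := by
    refine Algebra.TensorProduct.includeRight_injective (A := L) (algebraMap K L).injective
      (hH.bijective.1 (LinearMap.ext fun t => ?_))
    change canonicalMap K L H (1 ⊗ₜ a) t = canonicalMap K L H (1 ⊗ₜ b) t
    rw [canonicalMap_tmul, canonicalMap_tmul, h]

namespace RegularSubgroup

variable {K L E : Type*} [Field K] [Field L] [Field E] [CharZero K] [Algebra K L]
  [Module.Finite K L] [Algebra K E] [Algebra L E] [IsScalarTower K L E] [IsNormalClosure K L E]
  (N : RegularSubgroup K L E)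

theorem card_eq_finrank : Nat.card N.N = Module.finrank K L := by
  rw [N.card_eq, card_cosetSpace]

theorem finite : Finite N.N :=
  Nat.finite_of_card_ne_zero (by rw [N.card_eq_finrank]; exact Module.finrank_pos.ne')

end RegularSubgroup

section Identified

variable {K L E H : Type*} [Field K] [Field L] [Field E] [CharZero K] [Algebra K L]
  [Module.Finite K L] [Algebra K E] [Algebra L E] [IsScalarTower K L E] [IsNormalClosure K L E]
  [CommRing H] [HopfAlgebra K H] [Module H L] {N : RegularSubgroup K L E}

/-- The group `N` is commutative when `H` is. -/
abbrev Identification.commGroup (e : Identification K L E H N) : CommGroup N.N :=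
  { (inferInstance : Group N.N) with
    mul_comm := by
      have := finiteDimensional_of_isNormalClosure K L E
      refine N.mul_comm_of_fixedAlgebra fun a ha b hb => ?_
      have h := congrArg (fun z => ((e.equiv z : N.fixedAlgebra) : N.GroupAlgebra))
        (mul_comm (e.equiv.symm ⟨a, ha⟩) (e.equiv.symm ⟨b, hb⟩))
      simpa using h }

theorem Identification.isReduced (e : Identification K L E H N) : IsReduced H := by
  have := N.finite
  let _ := e.commGroup
  have : CharZero E := charZero_of_injective_algebraMap (algebraMap K E).injective
  have : IsReduced N.GroupAlgebra := MonoidAlgebra.isReduced_of_card_ne_zero (N := N.N)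
    (Nat.cast_ne_zero.2 Nat.card_pos.ne')
  exact isReduced_of_injective (N.fixedAlgebra.val.comp e.equiv.toAlgHom)
    (Subtype.val_injective.comp e.equiv.injective)

theorem Identification.mem_integralFixed (e : Identification K L E H N)
    (hp : ¬ p ∣ Module.finrank K L) [Algebra ℚ_[p] E]
    [Algebra ℤ_[p] K] [Algebra ℤ_[p] E] [Algebra ℤ_[p] H]
    [IsScalarTower ℤ_[p] ℚ_[p] E] [IsScalarTower ℤ_[p] K E] [IsScalarTower ℤ_[p] K H]
    {h : H} (hh : IsIntegral ℤ_[p] h) : e.equiv h ∈ N.integralFixed p := by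
  have := N.finite
  let _ := e.commGroup
  intro n
  rw [mem_intRing_iff]
  refine MonoidAlgebra.isIntegral_coeff (N := N.N)
    (isUnit_natCast_padicInt p (by rwa [N.card_eq_finrank]))
    ?_ n
  exact hh.map (N.fixedAlgebra.val.comp e.equiv.toAlgHom)

end Identified

/-- The value `h • x` is a combination of conjugates of `x` with integral coefficients, hence
integral in `E`; integrality descends along the injection `L → E`. -/
theorem Identification.mem_associatedOrder {K L E H : Type*} [Field K] [Field L] [Field E]
    [Algebra ℚ_[p] K] [Algebra ℚ_[p] L] [Algebra K L] [IsScalarTower ℚ_[p] K L]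
    [Algebra ℚ_[p] E] [Algebra K E] [IsScalarTower ℚ_[p] K E] [Algebra L E] [IsScalarTower K L E]
    [CommRing H] [HopfAlgebra K H] [Module H L] [IsScalarTower K H L] {N : RegularSubgroup K L E}
    (e : Identification K L E H N) {h : H} (hh : e.equiv h ∈ N.integralFixed p) :
    h ∈ associatedOrder p K L H := by
  intro x hx
  have h1 := N.apply_mem_intRing p hh hx
  rw [← e.smul_eq] at h1
  obtain ⟨f, hf, h0⟩ := h1
  refine ⟨f, hf, (algebraMap L E).injective ?_⟩
  rw [map_zero, Polynomial.hom_eval₂, ← RingHom.comp_assoc]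
  have hc : (algebraMap L E).comp (algebraMap ℚ_[p] L) = algebraMap ℚ_[p] E := by
    rw [IsScalarTower.algebraMap_eq ℚ_[p] K L, ← RingHom.comp_assoc,
      ← IsScalarTower.algebraMap_eq K L E, ← IsScalarTower.algebraMap_eq]
  rwa [hc]

end Padic

/-! ### The associated order as the ring of all integral elements. -/

section Main

variable {p : ℕ} [Fact p.Prime]

theorem fg_integralClosure (L : Type*) [Field L] [Algebra ℚ_[p] L] [Algebra ℤ_[p] L]
    [IsScalarTower ℤ_[p] ℚ_[p] L] [Module.Finite ℚ_[p] L] :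
    (Subalgebra.toSubmodule (integralClosure ℤ_[p] L)).FG :=
  Module.Finite.iff_fg.1 (IsIntegralClosure.finite ℤ_[p] ℚ_[p] L (integralClosure ℤ_[p] L))

theorem exists_smul_isIntegral (A : Type*) [CommRing A] [Algebra ℚ_[p] A] [Algebra ℤ_[p] A]
    [IsScalarTower ℤ_[p] ℚ_[p] A] [Module.Finite ℚ_[p] A] (x : A) :
    ∃ r : ℤ_[p], r ≠ 0 ∧ IsIntegral ℤ_[p] (r • x) := by
  have : Algebra.IsAlgebraic ℤ_[p] ℚ_[p] := IsLocalization.isAlgebraic ℚ_[p] (nonZeroDivisors ℤ_[p])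
  cases subsingleton_or_nontrivial A
  · exact ⟨1, one_ne_zero, by rw [Subsingleton.elim (_ • x) 0]; exact isIntegral_zero⟩
  have : Algebra.IsAlgebraic ℤ_[p] A := Algebra.IsAlgebraic.trans ℤ_[p] ℚ_[p] A
  obtain ⟨r, hr, h⟩ := (Algebra.IsAlgebraic.isAlgebraic (R := ℤ_[p]) x).exists_integral_multiple
  exact ⟨r, hr, h⟩

variable {K L H : Type*} [Field K] [Field L] [Algebra ℚ_[p] K] [Algebra ℚ_[p] L] [Algebra K L]
  [IsScalarTower ℚ_[p] K L] [CommRing H] [Algebra K H] [Module H L] [IsScalarTower K H L]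
  [Algebra ℤ_[p] L] [Algebra ℤ_[p] H] [IsScalarTower ℤ_[p] ℚ_[p] L] [IsScalarTower ℤ_[p] H L]

theorem mem_associatedOrder_iff_mem_stabilizer {h : H} :
    h ∈ associatedOrder p K L H ↔
      h ∈ (Subalgebra.toSubmodule (integralClosure ℤ_[p] L)).stabilizerSubalgebra H :=
  forall_congr' fun _ => imp_congr (mem_intRing_iff p) (mem_intRing_iff p)

variable [Algebra ℚ_[p] H] [IsScalarTower ℤ_[p] ℚ_[p] H] [Module.Finite ℚ_[p] L]
  [Module.Finite ℚ_[p] H] [IsReduced H] [FaithfulSMul H L]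

theorem fg_integralStabilizer : (Subalgebra.toSubmodule ((Subalgebra.toSubmodule
    (integralClosure ℤ_[p] L)).stabilizerSubalgebra H)).FG := by
  obtain ⟨v, hv, hv0⟩ := Submodule.exists_mem_smul_eq_zero_imp ℤ_[p] ℚ_[p] (H := H)
    (M := Subalgebra.toSubmodule (integralClosure ℤ_[p] L)) (exists_smul_isIntegral L)
  exact Submodule.stabilizerSubalgebra_fg (fg_integralClosure L) hv hv0

theorem isIntegral_of_mem_associatedOrder {h : H}
    (hh : h ∈ associatedOrder p K L H) : IsIntegral ℤ_[p] h :=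
  IsIntegral.of_mem_of_fg _ fg_integralStabilizer h (mem_associatedOrder_iff_mem_stabilizer.1 hh)

/-- If the associated order is the set of integral elements, then it is the unique maximal order. -/
theorem isUniqueMaximalOrder_of_mem_iff [Algebra ℤ_[p] K]
    [IsScalarTower ℤ_[p] ℚ_[p] K] [IsScalarTower ℚ_[p] K H]
    (hA : ∀ h : H, h ∈ associatedOrder p K L H ↔ IsIntegral ℤ_[p] h) :
    IsUniqueMaximalOrder (intRing p K) K (associatedOrder p K L H) := by
  have : IsScalarTower ℤ_[p] K H := .of_algebraMap_eq fun r => by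
    rw [IsScalarTower.algebraMap_apply ℤ_[p] ℚ_[p] H, IsScalarTower.algebraMap_apply ℚ_[p] K H,
      ← IsScalarTower.algebraMap_apply ℤ_[p] ℚ_[p] K]
  let _ : Algebra ℤ_[p] (intRing p K) := ((algebraMap ℤ_[p] K).codRestrict (intRing p K)
    fun r => (mem_intRing_iff p).2 isIntegral_algebraMap).toAlgebra
  have : IsScalarTower ℤ_[p] (intRing p K) K := .of_algebraMap_eq fun _ => rfl
  have : IsScalarTower ℤ_[p] (intRing p K) H := .of_algebraMap_eq fun r =>
    IsScalarTower.algebraMap_apply ℤ_[p] K H r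
  have : Algebra.IsIntegral ℤ_[p] (intRing p K) := ⟨fun x =>
    (isIntegral_algebraMap_iff (B := K) Subtype.val_injective).1 ((mem_intRing_iff p).1 x.2)⟩
  have horder : IsOrder (intRing p K) K (associatedOrder p K L H) := by
    refine ⟨Submodule.FG.of_restrictScalars ℤ_[p] ?_, ?_⟩
    · convert fg_integralStabilizer (p := p) (L := L) (H := H) using 1
      ext h
      exact mem_associatedOrder_iff_mem_stabilizer (p := p) (K := K) (L := L)
    · refine eq_top_iff.2 fun h _ => ?_
      obtain ⟨r, hr, hrh⟩ := exists_smul_isIntegral (p := p) H h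
      have hr' : algebraMap ℤ_[p] K r ≠ 0 := by
        rw [IsScalarTower.algebraMap_apply ℤ_[p] ℚ_[p] K]
        simpa using hr
      have h1 : h = (algebraMap ℤ_[p] K r)⁻¹ • (r • h) := by
        rw [← algebraMap_smul K r h, smul_smul, inv_mul_cancel₀ hr', one_smul]
      rw [h1]
      exact Submodule.smul_mem _ _ (Submodule.subset_span ((hA _).2 hrh))
  -- An order is finitely generated over `𝔒_K`, so its elements are integral over `𝔒_K` and, by
  -- transitivity, over `ℤ_p`.
  have hle : ∀ Λ : Subalgebra (intRing p K) H, IsOrder (intRing p K) K Λ →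
      Λ ≤ associatedOrder p K L H := fun Λ hΛ h hh =>
    (hA h).2 (isIntegral_trans h (IsIntegral.of_mem_of_fg Λ hΛ.fg h hh))
  exact ⟨⟨horder, fun Λ hΛ _ => hle Λ hΛ⟩, fun Λ hΛ =>
    le_antisymm (hle Λ hΛ.1) (hΛ.2 horder (hle Λ hΛ.1))⟩

theorem free_of_mem_iff [IsScalarTower ℚ_[p] H L]
    (hdim : Module.finrank ℚ_[p] H = Module.finrank ℚ_[p] L)
    (hA : ∀ h : H, h ∈ associatedOrder p K L H ↔ IsIntegral ℤ_[p] h) :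
    Module.Free (associatedOrder p K L H) (intRing p L) := by
  obtain ⟨w, hw, hw0, hgen⟩ := Submodule.exists_generator_integralClosure ℚ_[p] hdim
    (M := Subalgebra.toSubmodule (integralClosure ℤ_[p] L)) (fg_integralClosure L)
    (exists_smul_isIntegral L) fun h hh => mem_associatedOrder_iff_mem_stabilizer.1 ((hA h).2 hh)
  let w' : intRing p L := ⟨w, (mem_intRing_iff p).2 hw⟩
  let f : associatedOrder p K L H →ₗ[associatedOrder p K L H] intRing p L :=
    LinearMap.toSpanSingleton _ _ w'
  have hf : ∀ a, (f a : L) = a.1 • w := fun a => rfl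
  have hinj : Function.Injective f := (injective_iff_map_eq_zero f).2 fun a ha =>
    Subtype.ext (hw0 a.1 (by rw [← hf, ha]; rfl))
  have hsurj : Function.Surjective f := fun x => by
    obtain ⟨h, hh, hx⟩ := hgen x.1 ((mem_intRing_iff p).1 x.2)
    exact ⟨⟨h, (hA h).2 hh⟩, Subtype.ext hx⟩
  exact Module.Free.of_equiv (LinearEquiv.ofBijective f ⟨hinj, hsurj⟩)

end Main

end HopfGalois

end

theorem theorem2 (p : ℕ) [Fact p.Prime]
    {K L E H : Type*} [Field K] [Field L] [Field E]
    -- `K` is a `p`-adic field, `L / K` a finite extension with normal closure `E`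
    [Algebra ℚ_[p] K] [Module.Finite ℚ_[p] K]
    [Algebra ℚ_[p] L] [Algebra K L] [IsScalarTower ℚ_[p] K L] [Module.Finite K L]
    [Algebra ℚ_[p] E] [Algebra K E] [IsScalarTower ℚ_[p] K E]
    [Algebra L E] [IsScalarTower K L E] [IsNormalClosure K L E]
    -- `H` is a commutative Hopf algebra giving a Hopf-Galois structure on `L / K`
    [CommRing H] [HopfAlgebra K H] [Module H L] [IsScalarTower K H L]
    (hH : HopfGalois.IsHopfGalois K L H)
    (hp : ¬ p ∣ Module.finrank K L) :
    -- `H = E[N]^G` for some `N`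
    (∃ N : HopfGalois.RegularSubgroup K L E,
      Nonempty (HopfGalois.Identification K L E H N)) ∧
    -- `𝔄_H = 𝔒_E[N]^G`, whenever `H = E[N]^G`
    (∀ (N : HopfGalois.RegularSubgroup K L E) (e : HopfGalois.Identification K L E H N),
      e.equiv '' (HopfGalois.associatedOrder p K L H : Set H) = N.integralFixed p) ∧
    -- `𝔄_H` is the unique maximal order in `H`
    HopfGalois.IsUniqueMaximalOrder (HopfGalois.intRing p K) K
      (HopfGalois.associatedOrder p K L H) ∧
    -- `𝔒_L` is a free `𝔄_H`-module
    Module.Free (HopfGalois.associatedOrder p K L H) (HopfGalois.intRing p L) := by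
  have : CharZero K := charZero_of_injective_algebraMap (algebraMap ℚ_[p] K).injective
  have : Normal K E := IsNormalClosure.normal (K := L)
  let _ : Algebra ℤ_[p] K := ((algebraMap ℚ_[p] K).comp (algebraMap ℤ_[p] ℚ_[p])).toAlgebra
  let _ : Algebra ℤ_[p] L := ((algebraMap ℚ_[p] L).comp (algebraMap ℤ_[p] ℚ_[p])).toAlgebra
  let _ : Algebra ℤ_[p] E := ((algebraMap ℚ_[p] E).comp (algebraMap ℤ_[p] ℚ_[p])).toAlgebra
  let _ : Algebra ℚ_[p] H := ((algebraMap K H).comp (algebraMap ℚ_[p] K)).toAlgebra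
  let _ : Algebra ℤ_[p] H := ((algebraMap ℚ_[p] H).comp (algebraMap ℤ_[p] ℚ_[p])).toAlgebra
  have : IsScalarTower ℤ_[p] ℚ_[p] K := .of_algebraMap_eq fun _ => rfl
  have : IsScalarTower ℤ_[p] ℚ_[p] L := .of_algebraMap_eq fun _ => rfl
  have : IsScalarTower ℤ_[p] ℚ_[p] E := .of_algebraMap_eq fun _ => rfl
  have : IsScalarTower ℤ_[p] ℚ_[p] H := .of_algebraMap_eq fun _ => rfl
  have : IsScalarTower ℚ_[p] K H := .of_algebraMap_eq fun _ => rfl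
  have : IsScalarTower ℤ_[p] K H := .of_algebraMap_eq fun _ => rfl
  have : IsScalarTower ℤ_[p] K E := .of_algebraMap_eq fun r =>
    IsScalarTower.algebraMap_apply ℚ_[p] K E r
  have : IsScalarTower ℚ_[p] H L := .of_algebraMap_smul fun r x => by
    rw [IsScalarTower.algebraMap_apply ℚ_[p] K H, algebraMap_smul, algebraMap_smul]
  have : IsScalarTower ℤ_[p] H L := .of_algebraMap_smul fun r x => by
    rw [IsScalarTower.algebraMap_apply ℤ_[p] ℚ_[p] H, algebraMap_smul, algebraMap_smul]
  have := hH.finite_hopf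
  have : Module.Finite ℚ_[p] L := Module.Finite.trans K L
  have : Module.Finite ℚ_[p] H := Module.Finite.trans K H
  have : FaithfulSMul H L := HopfGalois.faithfulSMul hH
  let e₀ := HopfGalois.identification (E := E) hH
  have := e₀.isReduced
  -- The cycle of inclusions closes through the one identification `e₀`, but the resulting
  -- description of `𝔄_H` mentions no `N` and so serves every other identification.
  have hA : ∀ h : H, h ∈ HopfGalois.associatedOrder p K L H ↔ IsIntegral ℤ_[p] h := fun h =>
    ⟨HopfGalois.isIntegral_of_mem_associatedOrder, fun hh =>
      e₀.mem_associatedOrder p (e₀.mem_integralFixed p hp hh)⟩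
  have hdim : Module.finrank ℚ_[p] H = Module.finrank ℚ_[p] L := by
    rw [← Module.finrank_mul_finrank ℚ_[p] K H, ← Module.finrank_mul_finrank ℚ_[p] K L,
      HopfGalois.finrank_eq hH]
  refine ⟨⟨_, ⟨e₀⟩⟩, fun N e => ?_, HopfGalois.isUniqueMaximalOrder_of_mem_iff hA,
    HopfGalois.free_of_mem_iff hdim hA⟩
  ext z
  constructor
  · rintro ⟨h, hh, rfl⟩
    exact e.mem_integralFixed p hp ((hA h).1 hh)
  · intro hz
    refine ⟨e.equiv.symm z, e.mem_associatedOrder p ?_, e.equiv.apply_symm_apply z⟩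
    rwa [e.equiv.apply_symm_apply]
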